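/- Let $E(4,\mathbb R)\cong\mathbb R^9$ be the space of traceless symmetric real $4\times4$ matrices with the inner product $\langle A,B\rangle=\operatorname{tr}(AB^{t})$, and let $S^8$ be its unit sphere. Let $\widetilde{\mathcal D}_4$ be the set of all $\operatorname{diag}(\lambda_1,-\lambda_1,\lambda_2,-\lambda_2)\in S^8$ with $\lambda_1>\lambda_2>0$, let $P\in\operatorname{SO}(4)$ act on $E(4,\mathbb R)$ by $P\cdot A=P^{t}AP$, and let $\widetilde{\mathcal B}_{4,\mathbb R}=\operatorname{SO}(4)\cdot\widetilde{\mathcal D}_4$. A proper Dupin hypersurface $M$ of a unit sphere (the principal curvature is constant along each corresponding curvature surface, and the number of distinct principal curvatures is constant) is called weakly reducible if it has a principal curvature function $\lambda$ such that the orthogonal complement $T_\lambda^{\perp}$, in the tangent bundle $TM$, of the principal distribution $T_\lambda$ is integrable, that is, through every point of $M$ there passes an integral manifold of $T_\lambda^\perp$; otherwise $M$ is called weakly irreducible. **Proposition.** $\widetilde{\mathcal B}_{4,\mathbb R}$ is a proper Dupin hypersurface of $S^8$, and it is weakly irreducible. More precisely, let $\operatorname{grad}f_3=3\left[A^2-(\operatorname{tr}A^3)A-\tfrac14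 I\right]$ be the gradient at $A$ of $f_3=\operatorname{tr}A^3$ on $S^8$, and let $\rho_1=|\operatorname{grad}f_3|$. Then $-\operatorname{grad}f_3/\rho_1$ is a smooth unit normal field on $\widetilde{\mathcal B}_{4,\mathbb R}$, and with respect to it (and the shape operator $S_\xi X=-D_X\xi$) $\widetilde{\mathcal B}_{4,\mathbb R}$ has at every point exactly five distinct principal curvatures, given at $A=P^{t}\operatorname{diag}(\lambda_1,-\lambda_1,\lambda_2,-\lambda_2)P$ with $P\in\operatorname{SO}(4)$, $\lambda_1>\lambda_2>0$, by the smooth functions $$\kappa_1=\tfrac{3}{\rho_1}(\lambda_1+\lambda_2),\quad \kappa_2=-\kappa_1,\quad \kappa_3=\tfrac{3}{\rho_1}(\lambda_1-\lambda_2),\quad \kappa_4=-\kappa_3,\quad \kappa_5=0 .$$ For each $i=1,\dots,5$ the distribution $T_{\kappa_i}^{\perp}$ is not integrable. Moreover, let $A=\operatorname{diag}(\mu_1,\mu_2,\mu_3,\mu_4)=\operatorname{diag}(\lambda_1,-\lambda_1,\lambda_2,-\lambda_2)\in\widetilde{\mathcal D}_4$ and, for $i\ne j$, $\hat E_{ij}=\frac1{\sqrt2}(E_{ij}+E_{ji})$,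 where $E_{ij}$ are the matrix units. On a neighbourhood $W$ of $A$ in $\widetilde{\mathcal B}_{4,\mathbb R}$ there is a smooth map $P:W\to\operatorname{SO}(4)$ with $P(A)=I$ and $B\in P(B)\cdot\widetilde{\mathcal D}_4$ for all $B\in W$, such that the vector fields $Y_{ij}(B)=P(B)\cdot\hat E_{ij}$ ($1\le i<j\le4$) and $X_1(B)=B^3-(\operatorname{tr}B^4)B$ form a smooth orthogonal frame of $T\widetilde{\mathcal B}_{4,\mathbb R}$ over $W$, with $$T_{\kappa_1}=\operatorname{Span}\{Y_{13}\},\ T_{\kappa_2}=\operatorname{Span}\{Y_{24}\},\ T_{\kappa_3}=\operatorname{Span}\{Y_{14}\},\ T_{\kappa_4}=\operatorname{Span}\{Y_{23}\},\ T_{\kappa_5}=\operatorname{Span}\{Y_{12},Y_{34},X_1\},$$ and $$[Y_{12},Y_{23}](A)=\tfrac{-1}{\sqrt2}\tfrac{\mu_1-\mu_3}{(\mu_1-\mu_2)(\mu_2-\mu_3)}\hat E_{13},\qquad [Y_{12},Y_{14}](A)=\tfrac1{\sqrt2}\tfrac{\mu_2-\mu_4}{(\mu_1-\mu_2)(\mu_1-\mu_4)}\hat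 E_{24},$$ $$[Y_{12},Y_{24}](A)=\tfrac{-1}{\sqrt2}\tfrac{\mu_1-\mu_4}{(\mu_1-\mu_2)(\mu_2-\mu_4)}\hat E_{14},\qquad [Y_{12},Y_{13}](A)=\tfrac1{\sqrt2}\tfrac{\mu_2-\mu_3}{(\mu_1-\mu_2)(\mu_1-\mu_3)}\hat E_{23},$$ $$[Y_{13},Y_{14}](A)=\tfrac1{\sqrt2}\tfrac{\mu_3-\mu_4}{(\mu_1-\mu_3)(\mu_1-\mu_4)}\hat E_{34}.$$ -/

import Mathlib

open scoped ContDiff Topology RealInnerProductSpace Matrix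

noncomputable section

namespace AustereDupin

section Hypersurfaces

/-! ### Hypersurfaces of the unit sphere of a Euclidean space, described extrinsically -/

variable {E : Type*} [NormedAddCommGroup E] [InnerProductSpace ℝ E]

/-- `f` is smooth on the subset `M`: locally it is the restriction of a smooth map defined on an
open set of the ambient space. -/
def IsSmoothOn {F : Type*} [NormedAddCommGroup F] [NormedSpace ℝ F] (f : E → F) (M : Set E) :
    Prop :=
  ∀ p ∈ M, ∃ (U : Set E) (g : E → F),
    IsOpen U ∧ p ∈ U ∧ ContDiffOn ℝ ∞ g U ∧ ∀ x ∈ M ∩ U, f x = g x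

/-- `M` is an embedded smooth hypersurface of the unit sphere `S` of `E`: locally it is the zero
set in `S` of a smooth function whose differential does not vanish on the tangent space of `S`. -/
def IsSphereHypersurface (M : Set E) : Prop :=
  (∀ p ∈ M, ‖p‖ = 1) ∧
  ∀ p ∈ M, ∃ (U : Set E) (f : E → ℝ), IsOpen U ∧ p ∈ U ∧ ContDiffOn ℝ ∞ f U ∧
    (∀ x ∈ U, ‖x‖ = 1 → (x ∈ M ↔ f x = 0)) ∧
    ∃ v : E, ⟪p, v⟫ = 0 ∧ fderiv ℝ f p v ≠ 0

/-- `v` is the velocity at `p` of a smooth curve in `M`. -/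
def IsVelocity (M : Set E) (p v : E) : Prop :=
  ∃ γ : ℝ → E, ContDiff ℝ ∞ γ ∧ γ 0 = p ∧ (∀ᶠ t in 𝓝 (0 : ℝ), γ t ∈ M) ∧ HasDerivAt γ v 0

/-- The tangent space `T_p M`, spanned by the velocities of the smooth curves in `M` through `p`
(for an embedded submanifold these velocities already form a linear subspace). -/
def tangentSpace (M : Set E) (p : E) : Submodule ℝ E :=
  Submodule.span ℝ {v | IsVelocity M p v}

theorem IsVelocity.mem_tangentConeAt {M : Set E} {p v : E} (h : IsVelocity M p v) :
    v ∈ tangentConeAt ℝ M p := by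
  obtain ⟨γ, -, h0, hM, hd⟩ := h
  obtain ⟨s, hs, hsM⟩ := hM.exists_mem
  have h1 : HasFDerivWithinAt γ (ContinuousLinearMap.toSpanSingleton ℝ v) s 0 :=
    hd.hasFDerivAt.hasFDerivWithinAt
  have h2 := h1.mapsTo_tangent_cone
  have h3 : (1 : ℝ) ∈ tangentConeAt ℝ s (0 : ℝ) := by
    rw [tangentConeAt_of_mem_nhds hs]; trivial
  have h4 := h2 h3
  rw [h0] at h4
  have h5 : γ '' s ⊆ M := by
    rintro _ ⟨t, ht, rfl⟩
    exact hsM t ht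
  simpa using tangentConeAt_mono h5 h4

/-- On tangent vectors the derivative within `M` is the ordinary derivative of any smooth
extension. In particular it does not depend on any choice. -/
theorem fderivWithin_eq_of_extension {F : Type*} [NormedAddCommGroup F] [NormedSpace ℝ F]
    {M U : Set E} {f g : E → F} {p v : E} (hU : IsOpen U) (hpU : p ∈ U) (hpM : p ∈ M)
    (hg : DifferentiableAt ℝ g p) (hfg : ∀ x ∈ M ∩ U, f x = g x) (hv : v ∈ tangentSpace M p) :
    fderivWithin ℝ f M p v = fderiv ℝ g p v := by
  have h1 : HasFDerivWithinAt f (fderiv ℝ g p) M p := by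
    have h2 : HasFDerivWithinAt g (fderiv ℝ g p) (M ∩ U) p :=
      hg.hasFDerivAt.hasFDerivWithinAt
    have h3 : HasFDerivWithinAt f (fderiv ℝ g p) (M ∩ U) p :=
      h2.congr hfg (hfg p ⟨hpM, hpU⟩)
    exact (hasFDerivWithinAt_inter (hU.mem_nhds hpU)).1 h3
  have h4 := h1.differentiableWithinAt.hasFDerivWithinAt.unique_on h1
  unfold tangentSpace at hv
  induction hv using Submodule.span_induction with
  | mem x hx => exact h4 (IsVelocity.mem_tangentConeAt hx)
  | zero => simp
  | add x y _ _ hx hy => simp [hx, hy]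
  | smul c x _ hx => simp [hx]

/-- Likewise, for vector fields tangent to `M` the bracket within `M` is the ordinary Lie bracket
of any smooth extensions. -/
theorem lieBracketWithin_eq_of_extension {M U : Set E} {V W V' W' : E → E} {p : E}
    (hU : IsOpen U) (hpU : p ∈ U) (hpM : p ∈ M)
    (hV' : DifferentiableAt ℝ V' p) (hW' : DifferentiableAt ℝ W' p)
    (hV : ∀ x ∈ M ∩ U, V x = V' x) (hW : ∀ x ∈ M ∩ U, W x = W' x)
    (hVt : V p ∈ tangentSpace M p) (hWt : W p ∈ tangentSpace M p) :
    VectorField.lieBracketWithin ℝ V W M p = VectorField.lieBracket ℝ V' W' p := by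
  rw [VectorField.lieBracketWithin, VectorField.lieBracket_eq,
    fderivWithin_eq_of_extension hU hpU hpM hW' hW hVt,
    fderivWithin_eq_of_extension hU hpU hpM hV' hV hWt, hV p ⟨hpM, hpU⟩, hW p ⟨hpM, hpU⟩]

/-- `ξ` is a smooth unit normal field along the hypersurface `M` of the unit sphere: it is tangent
to the sphere and normal to `M`. -/
def IsUnitNormal (M : Set E) (ξ : E → E) : Prop :=
  IsSmoothOn ξ M ∧
  ∀ p ∈ M, ‖ξ p‖ = 1 ∧ ⟪p, ξ p⟫ = 0 ∧ ∀ v ∈ tangentSpace M p, ⟪v, ξ p⟫ = 0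

/-- The eigenspace `{v ∈ T_p M | S_ξ v = κ v}` of the shape operator `S_ξ v = - D_v ξ`. (As `M` lies
in the unit sphere and `ξ` is a unit normal field tangent to the sphere, `D_v ξ` is tangent to `M`,
and it is also the derivative of `ξ` for the Levi-Civita connection of the sphere.) -/
def principalSpace (M : Set E) (ξ : E → E) (p : E) (κ : ℝ) : Submodule ℝ E where
  carrier := {v | v ∈ tangentSpace M p ∧ -(fderivWithin ℝ ξ M p v) = κ • v}
  add_mem' := by
    rintro v w ⟨hv, hv'⟩ ⟨hw, hw'⟩
    exact ⟨add_mem hv hw, by rw [map_add, neg_add, hv', hw', smul_add]⟩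
  zero_mem' := ⟨zero_mem _, by simp⟩
  smul_mem' := by
    rintro c v ⟨hv, hv'⟩
    exact ⟨Submodule.smul_mem _ c hv, by rw [map_smul, ← smul_neg, hv', smul_comm]⟩

/-- `κ` is a principal curvature of `M` at `p` (with respect to the unit normal field `ξ`). -/
def IsPrincipalCurvature (M : Set E) (ξ : E → E) (p : E) (κ : ℝ) : Prop :=
  principalSpace M ξ p κ ≠ ⊥

/-- A parametrized submanifold of `M`: a smooth immersion `f` of an open set `O ⊆ ℝᵏ` into `M`. -/
def IsImmersionInto (M : Set E) {k : ℕ} (O : Set (EuclideanSpace ℝ (Fin k)))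
    (f : EuclideanSpace ℝ (Fin k) → E) : Prop :=
  IsOpen O ∧ ContDiffOn ℝ ∞ f O ∧
  ∀ x ∈ O, f x ∈ M ∧ Function.Injective (fderiv ℝ f x)

/-- Along each curvature surface the corresponding principal curvature is constant. A curvature
surface is a connected submanifold of `M` (of positive dimension) whose tangent space at each of
its points is the eigenspace of a principal curvature. -/
def IsDupin (M : Set E) (ξ : E → E) : Prop :=
  ∀ (k : ℕ) (O : Set (EuclideanSpace ℝ (Fin k))) (f : EuclideanSpace ℝ (Fin k) → E)
    (κ : EuclideanSpace ℝ (Fin k) → ℝ),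
    IsImmersionInto M O f → IsPreconnected O →
    (∀ x ∈ O, IsPrincipalCurvature M ξ (f x) (κ x) ∧
      LinearMap.range (fderiv ℝ f x : EuclideanSpace ℝ (Fin k) →ₗ[ℝ] E)
        = principalSpace M ξ (f x) (κ x)) →
    ∀ x ∈ O, ∀ y ∈ O, κ x = κ y

/-- `M` is an (orientable) proper Dupin hypersurface of the unit sphere: it is Dupin, and the number
of distinct principal curvatures is the same at all points. -/
def IsProperDupin (M : Set E) : Prop :=
  IsSphereHypersurface M ∧ ∃ ξ : E → E, IsUnitNormal M ξ ∧ IsDupin M ξ ∧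
    ∃ g : ℕ, ∀ p ∈ M, {κ : ℝ | IsPrincipalCurvature M ξ p κ}.encard = g

/-- The distribution `D` on `M` is integrable: through each point of `M` there passes an integral
manifold, that is, a submanifold whose tangent space at each of its points `q` is `D q`. -/
def IsIntegrable (M : Set E) (D : E → Submodule ℝ E) : Prop :=
  ∀ p ∈ M, ∃ (k : ℕ) (O : Set (EuclideanSpace ℝ (Fin k))) (f : EuclideanSpace ℝ (Fin k) → E),
    IsImmersionInto M O f ∧ (∃ x ∈ O, f x = p) ∧
    ∀ x ∈ O, LinearMap.range (fderiv ℝ f x : EuclideanSpace ℝ (Fin k) →ₗ[ℝ] E) = D (f x)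

/-- The conullity of the principal curvature function `lam`: the orthogonal complement in the
tangent bundle of `M` of the principal distribution belonging to `lam`. -/
def conullity (M : Set E) (ξ : E → E) (lam : E → ℝ) (p : E) : Submodule ℝ E :=
  tangentSpace M p ⊓ (principalSpace M ξ p (lam p))ᗮ

/-- A (proper Dupin) hypersurface `M` is weakly reducible if it has a principal curvature function
with integrable conullity. -/
def IsWeaklyReducible (M : Set E) : Prop :=
  ∃ ξ : E → E, IsUnitNormal M ξ ∧ ∃ lam : E → ℝ, ContinuousOn lam M ∧
    (∀ p ∈ M, IsPrincipalCurvature M ξ p (lam p)) ∧ IsIntegrable M (conullity M ξ lam)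

/-- A proper Dupin hypersurface that is not weakly reducible. -/
def IsWeaklyIrreducible (M : Set E) : Prop :=
  IsProperDupin M ∧ ¬ IsWeaklyReducible M

end Hypersurfaces

/-! ### The hypersurface -/

/-- The `9`-dimensional Euclidean space of traceless symmetric real `4 × 4` matrices, with inner
product `⟪A, B⟫ = tr (A Bᵀ) = ∑ i, j, A i j * B i j`, as a subspace of `ℝ^(4 × 4)`. -/
def symTraceless : Submodule ℝ (EuclideanSpace ℝ (Fin 4 × Fin 4)) where
  carrier := {A | (∀ i j, A (i, j) = A (j, i)) ∧ ∑ i, A (i, i) = 0}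
  add_mem' := by
    rintro A B ⟨hA, hA'⟩ ⟨hB, hB'⟩
    exact ⟨fun i j => by simp [hA i j, hB i j], by simp [Finset.sum_add_distrib, hA', hB']⟩
  zero_mem' := by simp
  smul_mem' := by
    rintro c A ⟨hA, hA'⟩
    exact ⟨fun i j => by simp [hA i j], by simp [← Finset.mul_sum, hA']⟩

/-- The space `E(4, ℝ)`; its unit sphere is `S⁸`. -/
abbrev SymMat : Type := symTraceless

/-- The matrix of an element of `E(4, ℝ)`. -/
def toMat (A : SymMat) : Matrix (Fin 4) (Fin 4) ℝ := Matrix.of fun i j => A.1 (i, j)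

/-- The element of `E(4, ℝ)` given by a traceless symmetric matrix. -/
def ofMat (M : Matrix (Fin 4) (Fin 4) ℝ) (h : Mᵀ = M) (h' : M.trace = 0) : SymMat :=
  ⟨WithLp.toLp 2 fun ij => M ij.1 ij.2,
    fun i j => congrFun (congrFun h j) i, by simpa [Matrix.trace] using h'⟩

theorem toMat_ofMat (M : Matrix (Fin 4) (Fin 4) ℝ) (h : Mᵀ = M) (h' : M.trace = 0) :
    toMat (ofMat M h h') = M := by
  ext i j; simp [toMat, ofMat]

theorem toMat_transpose (A : SymMat) : (toMat A)ᵀ = toMat A := by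
  ext i j; exact A.2.1 j i

theorem trace_toMat (A : SymMat) : (toMat A).trace = 0 := by
  simpa [Matrix.trace, toMat] using A.2.2

theorem inner_eq_trace (A B : SymMat) : ⟪A, B⟫ = (toMat A * (toMat B)ᵀ).trace := by
  rw [Submodule.coe_inner, PiLp.inner_apply, Fintype.sum_prod_type]
  simp [Matrix.trace, Matrix.mul_apply, toMat, mul_comm]

/-- The group `SO(4)`. -/
abbrev SO4 : Type := Matrix.specialOrthogonalGroup (Fin 4) ℝ

theorem SO4.mul_transpose (P : SO4) : P.1 * P.1ᵀ = 1 :=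
  (Matrix.mem_orthogonalGroup_iff (Fin 4) ℝ).1 (Matrix.mem_specialOrthogonalGroup_iff.1 P.2).1

/-- The isometric action `P · A = Pᵀ A P` of `SO(4)` on `E(4, ℝ)`. -/
def act (P : SO4) (A : SymMat) : SymMat :=
  ofMat (P.1ᵀ * toMat A * P.1)
    (by simp only [Matrix.transpose_mul, Matrix.transpose_transpose, toMat_transpose,
      Matrix.mul_assoc])
    (by rw [Matrix.trace_mul_comm, ← Matrix.mul_assoc, SO4.mul_transpose, Matrix.one_mul,
      trace_toMat])

/-- The diagonal matrix `diag (a, -a, b, -b)`. -/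
def diagPt (a b : ℝ) : SymMat :=
  ofMat (Matrix.diagonal ![a, -a, b, -b]) (Matrix.diagonal_transpose _)
    (by simp [Matrix.trace_diagonal, Fin.sum_univ_four])

/-- The set `𝓓̃₄` of all `diag (a, -a, b, -b)` with `a > b > 0` of norm one. -/
def Dtilde : Set SymMat := {D | ∃ a b : ℝ, 0 < b ∧ b < a ∧ D = diagPt a b ∧ ‖D‖ = 1}

/-- The hypersurface `𝓑̃₄ = SO(4) · 𝓓̃₄`. -/
def Btilde : Set SymMat := {A | ∃ P : SO4, ∃ D ∈ Dtilde, A = act P D}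

/-- The gradient `3 (A² - (tr A³) A - (tr A²) I / 4)` at `A` of the function `f₃ = tr A³` on the
unit sphere (where `tr A² = 1`). -/
def gradF3 (A : SymMat) : SymMat :=
  (3 : ℝ) • (ofMat (toMat A ^ 2 - ((toMat A ^ 2).trace / 4) • (1 : Matrix (Fin 4) (Fin 4) ℝ))
    (by simp [Matrix.transpose_pow, toMat_transpose])
    (by simp) - (toMat A ^ 3).trace • A)

/-- The length `ρ₁` of the gradient of `f₃`. -/
def rho (A : SymMat) : ℝ := ‖gradF3 A‖

/-- The unit normal field `- grad f₃ / |grad f₃|` of `𝓑̃₄`. -/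
def unitNormal (A : SymMat) : SymMat := -((rho A)⁻¹ • gradF3 A)

/-- `Ê i j = (E i j + E j i) / √2` for `i ≠ j`, where `E i j` is the matrix unit. -/
def Ehat (i j : Fin 4) : SymMat :=
  if h : i ≠ j then
    ofMat ((1 / √2 : ℝ) • (Matrix.single i j (1 : ℝ) + Matrix.single j i (1 : ℝ)))
      (by simp [add_comm])
      (by simp [Matrix.trace_single_eq_of_ne _ _ _ h, Matrix.trace_single_eq_of_ne _ _ _ h.symm])
  else 0

/-- `X₁ = A³ - (tr A⁴) A - (tr A³) I / 4`, a quarter of the gradient of `f₄ = tr A⁴` on the unit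
sphere; on `𝓑̃₄` the trace of `A³` is zero. -/
def X1 (A : SymMat) : SymMat :=
  ofMat (toMat A ^ 3 - ((toMat A ^ 3).trace / 4) • (1 : Matrix (Fin 4) (Fin 4) ℝ))
    (by simp [Matrix.transpose_pow, toMat_transpose])
    (by simp) - (toMat A ^ 4).trace • A

/-- `P` is a smooth local choice, on the neighbourhood `W` of `A` in `𝓑̃₄`, of a matrix in `SO(4)`
near the identity which diagonalizes: `B = P(B) · D` with `D ∈ 𝓓̃₄`, and `P(A) = I`. -/
def IsLocalDiagonalizer (A : SymMat) (W : Set SymMat) (P : SymMat → SO4) : Prop :=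
  IsOpen W ∧ A ∈ W ∧ P A = 1 ∧
  (∀ i j, IsSmoothOn (fun B => (P B).1 i j) (Btilde ∩ W)) ∧
  ∀ B ∈ Btilde ∩ W, ∃ D ∈ Dtilde, B = act (P B) D

/-- The vector field `Y i j (B) = P(B) · Ê i j`. -/
def Yfield (P : SymMat → SO4) (i j : Fin 4) (B : SymMat) : SymMat := act (P B) (Ehat i j)

/-- The frame `Y₁₂, Y₁₃, Y₁₄, Y₂₃, Y₂₄, Y₃₄, X₁` (with indices shifted to `0, …, 3`). -/
def frame (P : SymMat → SO4) : Fin 7 → SymMat → SymMat :=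
  ![Yfield P 0 1, Yfield P 0 2, Yfield P 0 3, Yfield P 1 2, Yfield P 1 3, Yfield P 2 3, X1]

end AustereDupin

end

open AustereDupin

noncomputable section

namespace AustereDupin

/-! ### Calculus along subsets -/

section Calculus

variable {E F : Type*} [NormedAddCommGroup E] [InnerProductSpace ℝ E]
  [NormedAddCommGroup F] [NormedSpace ℝ F]

/-! The hypersurface is homogeneous up to one parameter: every point is P·D with D = diag(a, -a, b,
-b), a² + b² = 1/2, and every object involved is SO(4)-equivariant, so computations happen at D. In
the unit sphere it is cut out by tr A³ = 0 and 0 < det A < 1/16: vanishing of tr A and tr A³ forces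
the eigenvalues into two opposite pairs (`exists_diagPt_of_trace_cube`), and the bounds on det =
a²b² exclude b = 0 and a = b.

At D the unit normal is -J/2 with J = diag(1, 1, -1, -1), independent of a and b. Rotating D in the
plane (i, j) moves D and the normal along the same direction Ê_ij, at speeds proportional to μ_i -
μ_j and -(J_i - J_j)/2; varying a and b leaves the normal fixed. So Ê_ij and X₁ diagonalize the
shape operator, with curvatures ±1/(a-b), ±1/(a+b) and 0 (`exists_curve`,
`principalSpace_act_diagPt`).

Dupin property: a principal curvature is 0 or exceeds 1 in absolute value, so on a connected
curvature surface it vanishes everywhere or nowhere. In the second case the surface is tangent to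
rotational directions only, det is constant along it, and a continuous κ with values in a fixed
finite set is constant (`isDupin_unitNormal`).

Non-integrability: a field normal to an immersed submanifold has a symmetric derivative along it
(`inner_fderiv_symm_of_orthogonal`). Suppose Y_pr lies in T while Y_pq and Y_qr lie in the
complement. On an integral manifold through D, symmetry of the derivative of Y_pr gives 1/(μ_r -
μ_q) = 1/(μ_p - μ_q), contradicting μ_p ≠ μ_r (`not_isIntegrable_of_frame`). Such a triple exists
for each of the five distributions. An arbitrary unit normal is locally ± the given one, and a
continuous principal curvature function is locally ± one of the five, so weak reducibility fails as
well (`exists_kappa_of_principalCurvature`).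

The frame needs a smooth diagonalizer: the eigenvalues are smooth in det, the spectral projections
are polynomials in B, and their normalized rows form P(B) (`localDiag_spec`). -/

theorem IsSmoothOn.exists_differentiableAt {f : E → F} {M : Set E} (hf : IsSmoothOn f M) {p : E}
    (hp : p ∈ M) : ∃ (U : Set E) (g : E → F), IsOpen U ∧ p ∈ U ∧ DifferentiableAt ℝ g p ∧
      ∀ x ∈ M ∩ U, f x = g x := by
  obtain ⟨U, g, hU, hpU, hg, hfg⟩ := hf p hp
  exact ⟨U, g, hU, hpU, ((hg p hpU).contDiffAt (hU.mem_nhds hpU)).differentiableAt (by simp), hfg⟩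

theorem IsSmoothOn.differentiableWithinAt {f : E → F} {M : Set E} (hf : IsSmoothOn f M) {p : E}
    (hp : p ∈ M) : DifferentiableWithinAt ℝ f M p := by
  obtain ⟨U, g, hU, hpU, hg, hfg⟩ := hf.exists_differentiableAt hp
  have h2 : DifferentiableWithinAt ℝ f (M ∩ U) p :=
    (hg.differentiableWithinAt).congr hfg (hfg p ⟨hp, hpU⟩)
  exact (differentiableWithinAt_inter (hU.mem_nhds hpU)).1 h2

theorem IsSmoothOn.of_contDiffOn {f g : E → F} {M U : Set E} (hU : IsOpen U)
    (hg : ContDiffOn ℝ ∞ g U) (hMU : M ⊆ U) (hfg : ∀ x ∈ M, f x = g x) : IsSmoothOn f M :=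
  fun _ hp => ⟨U, g, hU, hMU hp, hg, fun x hx => hfg x hx.1⟩

/-- The derivative within `M` in the direction of the velocity of a curve in `M`. -/
theorem fderivWithin_apply_of_curve {f : E → F} {M : Set E} {p v : E} {u : F} {γ : ℝ → E}
    (hf : DifferentiableWithinAt ℝ f M p) (h0 : γ 0 = p) (hγ : HasDerivAt γ v 0)
    (hM : ∀ᶠ t in 𝓝 (0 : ℝ), γ t ∈ M) (hu : HasDerivAt (fun t => f (γ t)) u 0) :
    fderivWithin ℝ f M p v = u :=
  (hf.hasFDerivWithinAt.comp_hasDerivAt_of_eq 0 hγ hM h0.symm).unique hu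

/-- A vector field `N` orthogonal to an immersed submanifold has a symmetric derivative along it. -/
theorem inner_fderiv_symm_of_orthogonal {k : ℕ} {f : EuclideanSpace ℝ (Fin k) → E} {N : E → E}
    {O : Set (EuclideanSpace ℝ (Fin k))} {x : EuclideanSpace ℝ (Fin k)} (hO : IsOpen O)
    (hx : x ∈ O) (hf : ContDiffOn ℝ ∞ f O) (hN : DifferentiableAt ℝ N (f x))
    (hperp : ∀ᶠ y in 𝓝 x, ∀ u, ⟪N (f y), fderiv ℝ f y u⟫ = 0) (u w : EuclideanSpace ℝ (Fin k)) :
    ⟪fderiv ℝ N (f x) (fderiv ℝ f x u), fderiv ℝ f x w⟫ =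
      ⟪fderiv ℝ N (f x) (fderiv ℝ f x w), fderiv ℝ f x u⟫ := by
  have hfx : ContDiffAt ℝ ∞ f x := (hf x hx).contDiffAt (hO.mem_nhds hx)
  have hsymm : IsSymmSndFDerivAt ℝ f x := hfx.isSymmSndFDerivAt
    (by rw [minSmoothness_of_isRCLikeNormedField]; exact WithTop.coe_le_coe.2 le_top)
  have hd : DifferentiableAt ℝ f x := hfx.differentiableAt (by simp)
  have hdd : DifferentiableAt ℝ (fderiv ℝ f) x :=
    (hfx.fderiv_right (m := 1) (WithTop.coe_le_coe.2 le_top)).differentiableAt (by simp)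
  -- Differentiate ⟪N ∘ f, df(u)⟫ = 0 in the direction w. Exchanging u and w leaves the second
  -- derivative term unchanged, so the other two terms agree.
  have key : ∀ u w : EuclideanSpace ℝ (Fin k),
      ⟪N (f x), fderiv ℝ (fderiv ℝ f) x w u⟫ +
        ⟪fderiv ℝ N (f x) (fderiv ℝ f x w), fderiv ℝ f x u⟫ = 0 := by
    intro u w
    have h1 : HasFDerivAt (fun y => N (f y)) ((fderiv ℝ N (f x)).comp (fderiv ℝ f x)) x :=
      hN.hasFDerivAt.comp x hd.hasFDerivAt
    have h2 : HasFDerivAt (fun y => fderiv ℝ f y u) ((fderiv ℝ (fderiv ℝ f) x).flip u) x := by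
      simpa using hdd.hasFDerivAt.clm_apply (hasFDerivAt_const u x)
    have h3 := h1.inner ℝ h2
    have h4 : HasFDerivAt (fun y => ⟪N (f y), fderiv ℝ f y u⟫)
        (0 : EuclideanSpace ℝ (Fin k) →L[ℝ] ℝ) x :=
      (hasFDerivAt_const (0 : ℝ) x).congr_of_eventuallyEq
        (hperp.mono fun y hy => hy u)
    have h5 := DFunLike.congr_fun (h3.unique h4) w
    simpa [fderivInnerCLM_apply] using h5
  have e1 := key u w
  have e2 := key w u
  have e3 := hsymm.eq u w
  rw [e3] at e2
  linarith

end Calculus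

/-! ### Coordinates on `SymMat` -/

theorem toMat_injective : Function.Injective toMat := by
  intro A B h
  ext ⟨i, j⟩
  exact congrFun (congrFun h i) j

@[simp] theorem toMat_add (A B : SymMat) : toMat (A + B) = toMat A + toMat B := rfl
@[simp] theorem toMat_sub (A B : SymMat) : toMat (A - B) = toMat A - toMat B := rfl
@[simp] theorem toMat_neg (A : SymMat) : toMat (-A) = -toMat A := rfl
@[simp] theorem toMat_smul (c : ℝ) (A : SymMat) : toMat (c • A) = c • toMat A := rfl
@[simp] theorem toMat_zero : toMat 0 = 0 := rfl

theorem toMat_symm (A : SymMat) (i j : Fin 4) : toMat A i j = toMat A j i := A.2.1 i j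

theorem inner_eq_trace_mul (A B : SymMat) : ⟪A, B⟫ = (toMat A * toMat B).trace := by
  rw [inner_eq_trace, toMat_transpose]

/-- The projection of a matrix to its traceless symmetric part. -/
def symPart (X : Matrix (Fin 4) (Fin 4) ℝ) : SymMat :=
  symTraceless.orthogonalProjectionOnto (WithLp.toLp 2 fun ij => X ij.1 ij.2)

theorem symPart_toMat (A : SymMat) : symPart (toMat A) = A := by
  have : (WithLp.toLp 2 fun ij : Fin 4 × Fin 4 => toMat A ij.1 ij.2) =
      (A : EuclideanSpace ℝ (Fin 4 × Fin 4)) := by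
    ext ⟨i, j⟩; rfl
  rw [symPart, this]
  exact Submodule.orthogonalProjectionOnto_mem_subspace_eq_self A

/-! ### Matrix-valued smooth functions, entry by entry -/

/-- All entries of the matrix-valued function `G` are smooth on `s`. -/
def MatSmoothOn {F : Type*} [NormedAddCommGroup F] [NormedSpace ℝ F]
    (G : F → Matrix (Fin 4) (Fin 4) ℝ) (s : Set F) : Prop :=
  ∀ i j, ContDiffOn ℝ ∞ (fun x => G x i j) s

namespace MatSmoothOn

variable {F : Type*} [NormedAddCommGroup F] [NormedSpace ℝ F]
  {G H : F → Matrix (Fin 4) (Fin 4) ℝ} {s : Set F}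

theorem const (C : Matrix (Fin 4) (Fin 4) ℝ) : MatSmoothOn (fun _ : F => C) s :=
  fun _ _ => contDiffOn_const

theorem add (hG : MatSmoothOn G s) (hH : MatSmoothOn H s) : MatSmoothOn (fun x => G x + H x) s :=
  fun i j => (hG i j).add (hH i j)

theorem sub (hG : MatSmoothOn G s) (hH : MatSmoothOn H s) : MatSmoothOn (fun x => G x - H x) s :=
  fun i j => (hG i j).sub (hH i j)

theorem smul {c : F → ℝ} (hc : ContDiffOn ℝ ∞ c s) (hG : MatSmoothOn G s) :
    MatSmoothOn (fun x => c x • G x) s :=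
  fun i j => hc.mul (hG i j)

theorem transpose (hG : MatSmoothOn G s) : MatSmoothOn (fun x => (G x)ᵀ) s :=
  fun i j => hG j i

theorem mul (hG : MatSmoothOn G s) (hH : MatSmoothOn H s) : MatSmoothOn (fun x => G x * H x) s := by
  intro i j
  simp only [Matrix.mul_apply]
  exact ContDiffOn.sum fun k _ => (hG i k).mul (hH k j)

theorem pow (hG : MatSmoothOn G s) (n : ℕ) : MatSmoothOn (fun x => G x ^ n) s := by
  induction n with
  | zero => simpa using const 1
  | succ n ih => simpa only [pow_succ] using ih.mul hG

theorem trace (hG : MatSmoothOn G s) : ContDiffOn ℝ ∞ (fun x => (G x).trace) s := by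
  simp only [Matrix.trace, Matrix.diag]
  exact ContDiffOn.sum fun k _ => hG k k

theorem det (hG : MatSmoothOn G s) : ContDiffOn ℝ ∞ (fun x => (G x).det) s := by
  simp only [Matrix.det_apply]
  refine ContDiffOn.sum fun σ _ => ContDiffOn.const_smul _ ?_
  exact contDiffOn_prod fun i _ => hG _ _

theorem symPart (hG : MatSmoothOn G s) : ContDiffOn ℝ ∞ (fun x => symPart (G x)) s := by
  refine ContDiffOn.continuousLinearMap_comp symTraceless.orthogonalProjectionOnto ?_
  exact (contDiffOn_euclidean (𝕜 := ℝ)).2 fun ij => hG ij.1 ij.2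

end MatSmoothOn

theorem matSmoothOn_toMat {F : Type*} [NormedAddCommGroup F] [NormedSpace ℝ F] {f : F → SymMat}
    {s : Set F} (hf : ContDiffOn ℝ ∞ f s) : MatSmoothOn (fun x => toMat (f x)) s := by
  intro i j
  have h1 : ContDiffOn ℝ ∞ (fun x => (f x).1) s :=
    hf.continuousLinearMap_comp symTraceless.subtypeL
  exact (contDiffOn_euclidean (𝕜 := ℝ)).1 h1 (i, j)

/-- Composing with the linear projection `symPart`, which is inverse to `toMat` on its range,
reduces smoothness into the subspace to smoothness of the sixteen entries. -/
theorem contDiffOn_of_toMat {F : Type*} [NormedAddCommGroup F] [NormedSpace ℝ F] {f : F → SymMat}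
    {s : Set F} (hf : MatSmoothOn (fun x => toMat (f x)) s) : ContDiffOn ℝ ∞ f s := by
  have := hf.symPart
  simpa only [symPart_toMat] using this

/-- `G'` is the derivative at `0` of the matrix-valued curve `G`, entry by entry. -/
def HasMatDeriv (G : ℝ → Matrix (Fin 4) (Fin 4) ℝ) (G' : Matrix (Fin 4) (Fin 4) ℝ) : Prop :=
  ∀ i j, HasDerivAt (fun t => G t i j) (G' i j) 0

namespace HasMatDeriv

variable {G H : ℝ → Matrix (Fin 4) (Fin 4) ℝ} {G' H' : Matrix (Fin 4) (Fin 4) ℝ}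

theorem const (C : Matrix (Fin 4) (Fin 4) ℝ) : HasMatDeriv (fun _ => C) 0 :=
  fun _ _ => hasDerivAt_const _ _

theorem transpose (hG : HasMatDeriv G G') : HasMatDeriv (fun t => (G t)ᵀ) G'ᵀ :=
  fun i j => hG j i

theorem mul (hG : HasMatDeriv G G') (hH : HasMatDeriv H H') :
    HasMatDeriv (fun t => G t * H t) (G' * H 0 + G 0 * H') := by
  intro i j
  simp only [Matrix.mul_apply, Matrix.add_apply, ← Finset.sum_add_distrib]
  exact HasDerivAt.fun_sum fun k _ => (hG i k).mul (hH k j)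

theorem trace (hG : HasMatDeriv G G') : HasDerivAt (fun t => (G t).trace) G'.trace 0 := by
  simp only [Matrix.trace, Matrix.diag]
  exact HasDerivAt.fun_sum fun k _ => hG k k

theorem of_hasDerivAt {f : ℝ → SymMat} {v : SymMat} (hf : HasDerivAt f v 0) :
    HasMatDeriv (fun t => toMat (f t)) (toMat v) := by
  intro i j
  exact ((EuclideanSpace.proj (𝕜 := ℝ) (i, j)).comp symTraceless.subtypeL).hasFDerivAt.comp_hasDerivAt
    0 hf

theorem hasDerivAt {f : ℝ → SymMat} {v : SymMat}
    (hf : HasMatDeriv (fun t => toMat (f t)) (toMat v)) : HasDerivAt f v 0 := by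
  have h1 : HasDerivAt (fun t => (f t).1) v.1 0 := by
    rw [hasDerivAt_iff_hasFDerivAt, ← hasFDerivWithinAt_univ, hasFDerivWithinAt_euclidean]
    rintro ⟨i, j⟩
    rw [hasFDerivWithinAt_univ]
    have h : HasFDerivAt (fun t => (f t).1 (i, j)) _ 0 := (hf i j).hasFDerivAt
    have e : PiLp.proj (𝕜 := ℝ) 2 (fun _ => ℝ) (i, j) ∘SL ContinuousLinearMap.toSpanSingleton ℝ v.1 =
        ContinuousLinearMap.toSpanSingleton ℝ (toMat v i j) := by
      ext
      simp [toMat]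
    exact e ▸ h
  have h2 := symTraceless.orthogonalProjectionOnto.hasFDerivAt.comp_hasDerivAt 0 h1
  simpa [Function.comp_def] using h2

end HasMatDeriv

/-! ### The action of `SO(4)` -/

theorem SO4.transpose_mul (P : SO4) : P.1ᵀ * P.1 = 1 :=
  mul_eq_one_comm.1 (SO4.mul_transpose P)

theorem mem_SO4 {X : Matrix (Fin 4) (Fin 4) ℝ} (h : X * Xᵀ = 1) (h' : X.det = 1) :
    X ∈ Matrix.specialOrthogonalGroup (Fin 4) ℝ :=
  Matrix.mem_specialOrthogonalGroup_iff.2 ⟨(Matrix.mem_orthogonalGroup_iff (Fin 4) ℝ).2 h, h'⟩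

@[simp] theorem toMat_act (P : SO4) (A : SymMat) : toMat (act P A) = P.1ᵀ * toMat A * P.1 :=
  toMat_ofMat _ _ _

@[simp] theorem act_one (A : SymMat) : act 1 A = A := toMat_injective (by simp)

theorem act_mul (P Q : SO4) (A : SymMat) : act (P * Q) A = act Q (act P A) :=
  toMat_injective (by simp [Matrix.transpose_mul, Matrix.mul_assoc])

theorem act_add (P : SO4) (A B : SymMat) : act P (A + B) = act P A + act P B :=
  toMat_injective (by simp [mul_add, add_mul])

theorem act_smul (P : SO4) (c : ℝ) (A : SymMat) : act P (c • A) = c • act P A :=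
  toMat_injective (by simp)

theorem act_act_inv (P : SO4) (A : SymMat) : act P (act P⁻¹ A) = A := by
  rw [← act_mul, inv_mul_cancel, act_one]

theorem conj_pow {P : Matrix (Fin 4) (Fin 4) ℝ} (hP : P * Pᵀ = 1) (X : Matrix (Fin 4) (Fin 4) ℝ)
    (n : ℕ) : (Pᵀ * X * P) ^ n = Pᵀ * X ^ n * P := by
  induction n with
  | zero => simp [mul_eq_one_comm.1 hP]
  | succ n ih =>
    rw [pow_succ, ih, pow_succ]
    calc Pᵀ * X ^ n * P * (Pᵀ * X * P) = Pᵀ * X ^ n * (P * Pᵀ) * X * P := by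
          simp only [Matrix.mul_assoc]
      _ = _ := by rw [hP]; simp only [Matrix.mul_assoc, Matrix.one_mul]

theorem trace_conj {P : Matrix (Fin 4) (Fin 4) ℝ} (hP : P * Pᵀ = 1)
    (X : Matrix (Fin 4) (Fin 4) ℝ) : (Pᵀ * X * P).trace = X.trace := by
  rw [Matrix.trace_mul_comm, ← Matrix.mul_assoc, hP, Matrix.one_mul]

theorem det_conj {P : Matrix (Fin 4) (Fin 4) ℝ} (hP : P * Pᵀ = 1)
    (X : Matrix (Fin 4) (Fin 4) ℝ) : (Pᵀ * X * P).det = X.det := by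
  have h : P.det * P.det = 1 := by simpa using congrArg Matrix.det hP
  rw [Matrix.det_mul, Matrix.det_mul, Matrix.det_transpose]
  linear_combination X.det * h

theorem inner_act_act (P : SO4) (A B : SymMat) : ⟪act P A, act P B⟫ = ⟪A, B⟫ := by
  rw [inner_eq_trace_mul, inner_eq_trace_mul, toMat_act, toMat_act,
    ← trace_conj P.mul_transpose (toMat A * toMat B)]
  congr 1
  calc _ = P.1ᵀ * toMat A * (P.1 * P.1ᵀ) * toMat B * P.1 := by simp only [Matrix.mul_assoc]
    _ = _ := by rw [P.mul_transpose]; simp only [Matrix.mul_assoc, Matrix.one_mul]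

theorem norm_act (P : SO4) (A : SymMat) : ‖act P A‖ = ‖A‖ := by
  rw [norm_eq_sqrt_real_inner, norm_eq_sqrt_real_inner, inner_act_act]

/-- The action of `P` as a linear map. -/
def actL (P : SO4) : SymMat →L[ℝ] SymMat :=
  LinearMap.toContinuousLinearMap
    { toFun := act P
      map_add' := act_add P
      map_smul' := act_smul P }

@[simp] theorem actL_apply (P : SO4) (A : SymMat) : actL P A = act P A := rfl

theorem act_neg (P : SO4) (A : SymMat) : act P (-A) = -act P A := (actL P).map_neg A

theorem toMat_gradF3 (A : SymMat) : toMat (gradF3 A) = (3 : ℝ) • (toMat A ^ 2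
    - ((toMat A ^ 2).trace / 4) • (1 : Matrix (Fin 4) (Fin 4) ℝ) - (toMat A ^ 3).trace • toMat A) := by
  simp [gradF3, toMat_ofMat]

theorem toMat_X1 (A : SymMat) : toMat (X1 A) = toMat A ^ 3
    - ((toMat A ^ 3).trace / 4) • (1 : Matrix (Fin 4) (Fin 4) ℝ) - (toMat A ^ 4).trace • toMat A := by
  simp [X1, toMat_ofMat]

theorem gradF3_act (P : SO4) (A : SymMat) : gradF3 (act P A) = act P (gradF3 A) := by
  apply toMat_injective
  rw [toMat_gradF3, toMat_act, toMat_act, toMat_gradF3, conj_pow P.mul_transpose,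
    conj_pow P.mul_transpose, trace_conj P.mul_transpose, trace_conj P.mul_transpose]
  simp only [Matrix.mul_smul, Matrix.smul_mul, Matrix.mul_sub, Matrix.sub_mul, Matrix.mul_one,
    P.transpose_mul]

theorem X1_act (P : SO4) (A : SymMat) : X1 (act P A) = act P (X1 A) := by
  apply toMat_injective
  rw [toMat_X1, toMat_act, toMat_act, toMat_X1, conj_pow P.mul_transpose,
    conj_pow P.mul_transpose, trace_conj P.mul_transpose, trace_conj P.mul_transpose]
  simp only [Matrix.mul_smul, Matrix.smul_mul, Matrix.mul_sub, Matrix.sub_mul, Matrix.mul_one,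
    P.transpose_mul]

theorem rho_act (P : SO4) (A : SymMat) : rho (act P A) = rho A := by
  rw [rho, gradF3_act, norm_act, rho]

theorem unitNormal_act (P : SO4) (A : SymMat) : unitNormal (act P A) = act P (unitNormal A) := by
  rw [unitNormal, rho_act, gradF3_act, unitNormal, act_neg, act_smul]

/-! ### Diagonal matrices -/

@[simp] theorem toMat_diagPt (a b : ℝ) :
    toMat (diagPt a b) = Matrix.diagonal ![a, -a, b, -b] := toMat_ofMat _ _ _

/-- The matrix `diag (1, 1, -1, -1)`. -/
def diagJ : SymMat :=
  ofMat (Matrix.diagonal ![1, 1, -1, -1]) (Matrix.diagonal_transpose _)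
    (by simp [Matrix.trace_diagonal, Fin.sum_univ_four])

@[simp] theorem toMat_diagJ : toMat diagJ = Matrix.diagonal ![1, 1, -1, -1] := toMat_ofMat _ _ _

theorem inner_diagonal (A : SymMat) {D : SymMat} {ν : Fin 4 → ℝ}
    (hD : toMat D = Matrix.diagonal ν) : ⟪A, D⟫ = ∑ i, toMat A i i * ν i := by
  rw [inner_eq_trace_mul, hD]
  simp [Matrix.trace, Matrix.mul_diagonal]

theorem norm_sq_diagPt (a b : ℝ) : ‖diagPt a b‖ ^ 2 = 2 * a ^ 2 + 2 * b ^ 2 := by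
  rw [← real_inner_self_eq_norm_sq, inner_diagonal _ (toMat_diagPt a b), toMat_diagPt]
  simp [Fin.sum_univ_four]
  ring

theorem norm_diagPt_eq_one_iff (a b : ℝ) : ‖diagPt a b‖ = 1 ↔ a ^ 2 + b ^ 2 = 1 / 2 := by
  rw [← sq_eq_sq₀ (norm_nonneg _) zero_le_one, norm_sq_diagPt]
  constructor <;> intro h <;> linarith

theorem norm_diagJ : ‖diagJ‖ = 2 := by
  rw [← sq_eq_sq₀ (norm_nonneg _) zero_le_two, ← real_inner_self_eq_norm_sq,
    inner_diagonal _ toMat_diagJ, toMat_diagJ]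
  simp [Fin.sum_univ_four]
  norm_num

theorem det_diagPt (a b : ℝ) : (toMat (diagPt a b)).det = a ^ 2 * b ^ 2 := by
  simp [Fin.prod_univ_four]
  ring

theorem trace_cube_diagPt (a b : ℝ) : (toMat (diagPt a b) ^ 3).trace = 0 := by
  simp [Matrix.diagonal_pow, Matrix.trace_diagonal, Fin.sum_univ_four]
  ring

/-- The cubic trace vanishes and A² = diag(a², a², b², b²); subtracting 1/4 = (a² + b²)/2 from the
diagonal leaves (a² - b²)/2 times J. -/
theorem gradF3_diagPt {a b : ℝ} (h : a ^ 2 + b ^ 2 = 1 / 2) :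
    gradF3 (diagPt a b) = (3 * (a ^ 2 - b ^ 2) / 2) • diagJ := by
  apply toMat_injective
  rw [toMat_gradF3, trace_cube_diagPt, toMat_smul, toMat_diagJ, toMat_diagPt, Matrix.diagonal_pow,
    Matrix.trace_diagonal]
  ext i j
  by_cases hij : i = j
  · subst hij
    fin_cases i <;> simp [Fin.sum_univ_four] <;> linarith
  · simp [hij]

theorem rho_diagPt {a b : ℝ} (hb : 0 < b) (hab : b < a) (h : a ^ 2 + b ^ 2 = 1 / 2) :
    rho (diagPt a b) = 3 * (a ^ 2 - b ^ 2) := by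
  have : 0 < a ^ 2 - b ^ 2 := by nlinarith
  rw [rho, gradF3_diagPt h, norm_smul, norm_diagJ, Real.norm_eq_abs, abs_of_pos (by linarith)]
  ring

theorem unitNormal_diagPt {a b : ℝ} (hb : 0 < b) (hab : b < a) (h : a ^ 2 + b ^ 2 = 1 / 2) :
    unitNormal (diagPt a b) = (-(1 / 2) : ℝ) • diagJ := by
  have : 0 < a ^ 2 - b ^ 2 := by nlinarith
  rw [unitNormal, rho_diagPt hb hab h, gradF3_diagPt h, smul_smul, ← neg_smul]
  congr 1
  field_simp

/-- X₁ is thus tangent to the circle of diagonal points: diag(b, -b, -a, a) is D turned by a right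
angle in the plane of the matrices diag(x, -x, y, -y). -/
theorem X1_diagPt {a b : ℝ} (h : a ^ 2 + b ^ 2 = 1 / 2) :
    X1 (diagPt a b) = (2 * a * b * (a ^ 2 - b ^ 2)) • diagPt b (-a) := by
  apply toMat_injective
  rw [toMat_X1, trace_cube_diagPt, toMat_smul, toMat_diagPt, toMat_diagPt, Matrix.diagonal_pow,
    Matrix.diagonal_pow, Matrix.trace_diagonal]
  ext i j
  by_cases hij : i = j
  · subst hij
    have hb : b ^ 2 = 1 / 2 - a ^ 2 := by linarith
    have h3 : b ^ 3 = b * (1 / 2 - a ^ 2) := by rw [← hb]; ring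
    have h4 : b ^ 4 = (1 / 2 - a ^ 2) ^ 2 := by rw [← hb]; ring
    have h5 : b ^ 5 = b * (1 / 2 - a ^ 2) ^ 2 := by rw [← hb]; ring
    fin_cases i <;> simp [Fin.sum_univ_four] <;> ring_nf <;> simp only [hb, h3, h4, h5] <;> ring
  · simp [hij]

theorem mem_Btilde_iff {B : SymMat} : B ∈ Btilde ↔ ∃ (P : SO4) (a b : ℝ), 0 < b ∧ b < a ∧
    a ^ 2 + b ^ 2 = 1 / 2 ∧ B = act P (diagPt a b) := by
  constructor
  · rintro ⟨P, D, ⟨a, b, hb, hab, rfl, hD⟩, rfl⟩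
    exact ⟨P, a, b, hb, hab, (norm_diagPt_eq_one_iff a b).1 hD, rfl⟩
  · rintro ⟨P, a, b, hb, hab, h, rfl⟩
    exact ⟨P, _, ⟨a, b, hb, hab, rfl, (norm_diagPt_eq_one_iff a b).2 h⟩, rfl⟩

/-! ### The matrices `Ê i j` -/

theorem toMat_Ehat {i j : Fin 4} (h : i ≠ j) : toMat (Ehat i j) =
    (1 / √2 : ℝ) • (Matrix.single i j (1 : ℝ) + Matrix.single j i (1 : ℝ)) := by
  rw [Ehat, dif_pos h, toMat_ofMat]

theorem inner_Ehat (A : SymMat) {i j : Fin 4} (h : i ≠ j) : ⟪A, Ehat i j⟫ = √2 * toMat A i j := by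
  rw [inner_eq_trace_mul, toMat_Ehat h]
  have h2 : √2 * √2 = (2 : ℝ) := Real.mul_self_sqrt zero_le_two
  have h3 : √2 ≠ (0 : ℝ) := by positivity
  simp only [Matrix.mul_smul, Matrix.mul_add, Matrix.trace_smul, Matrix.trace_add,
    Matrix.trace_mul_single, toMat_symm A j i]
  simp
  field_simp
  linear_combination (-toMat A i j) * h2

/-! ### Rotations in coordinate planes -/

/-- The generator of the rotations in the plane of the coordinates `i` and `j`. -/
def rotGen (i j : Fin 4) : Matrix (Fin 4) (Fin 4) ℝ := Matrix.single i j 1 - Matrix.single j i 1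

/-- The rotation by the angle `t` in the plane of the coordinates `i` and `j`. -/
def rot (i j : Fin 4) (t : ℝ) : Matrix (Fin 4) (Fin 4) ℝ :=
  1 + (Real.cos t - 1) • (Matrix.single i i 1 + Matrix.single j j 1) + Real.sin t • rotGen i j

theorem rot_mul_rot {i j : Fin 4} (h : i ≠ j) (s t : ℝ) :
    rot i j s * rot i j t = rot i j (s + t) := by
  have h' := h.symm
  rw [rot, rot, rot, rotGen, Real.cos_add, Real.sin_add]
  simp only [add_mul, mul_add, sub_mul, mul_sub, Matrix.smul_mul, Matrix.mul_smul, smul_add,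
    smul_sub, Matrix.one_mul, Matrix.single_mul_single_same,
    Matrix.single_mul_single_of_ne, ne_eq, h, h', not_false_eq_true, smul_zero, mul_one]
  module

theorem rot_zero (i j : Fin 4) : rot i j 0 = 1 := by simp [rot]

theorem transpose_rot (i j : Fin 4) (t : ℝ) : (rot i j t)ᵀ = rot i j (-t) := by
  simp only [rot, rotGen, Matrix.transpose_add, Matrix.transpose_smul, Matrix.transpose_sub,
    Matrix.transpose_one, Matrix.transpose_single, Real.cos_neg, Real.sin_neg]
  module

theorem rot_mul_transpose {i j : Fin 4} (h : i ≠ j) (t : ℝ) : rot i j t * (rot i j t)ᵀ = 1 := by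
  rw [transpose_rot, rot_mul_rot h, add_neg_cancel, rot_zero]

theorem det_rot {i j : Fin 4} (h : i ≠ j) (t : ℝ) : (rot i j t).det = 1 := by
  -- Orthogonality only gives determinant ±1; the rotation is the square of the one by half the
  -- angle, which fixes the sign.
  have h1 : (rot i j (t / 2)).det * (rot i j (t / 2)).det = 1 := by
    simpa using congrArg Matrix.det (rot_mul_transpose h (t / 2))
  rw [← add_halves t, ← rot_mul_rot h, Matrix.det_mul, h1]

/-- The rotation as an element of `SO(4)`. -/
def rotSO {i j : Fin 4} (h : i ≠ j) (t : ℝ) : SO4 :=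
  ⟨rot i j t, mem_SO4 (rot_mul_transpose h t) (det_rot h t)⟩

theorem rotSO_zero {i j : Fin 4} (h : i ≠ j) : rotSO h 0 = 1 := Subtype.ext (rot_zero i j)

theorem matSmoothOn_rot (i j : Fin 4) : MatSmoothOn (rot i j) Set.univ :=
  ((MatSmoothOn.const 1).add (MatSmoothOn.smul
    (Real.contDiff_cos.contDiffOn.sub contDiffOn_const) (MatSmoothOn.const _))).add
    (MatSmoothOn.smul Real.contDiff_sin.contDiffOn (MatSmoothOn.const _))

theorem hasMatDeriv_rot (i j : Fin 4) : HasMatDeriv (rot i j) (rotGen i j) := by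
  intro k l
  have h1 := ((Real.hasDerivAt_cos 0).sub_const 1).mul_const
    ((Matrix.single i i (1 : ℝ) + Matrix.single j j 1 : Matrix (Fin 4) (Fin 4) ℝ) k l)
  have h2 := (Real.hasDerivAt_sin 0).mul_const (rotGen i j k l)
  have h3 := (h1.const_add ((1 : Matrix (Fin 4) (Fin 4) ℝ) k l)).add h2
  exact h3.congr_deriv (by simp)

theorem contDiff_act_rot {i j : Fin 4} (h : i ≠ j) (V : SymMat) :
    ContDiff ℝ ∞ fun t => act (rotSO h t) V := by
  rw [← contDiffOn_univ]
  apply contDiffOn_of_toMat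
  simp only [toMat_act]
  exact ((matSmoothOn_rot i j).transpose.mul (MatSmoothOn.const _)).mul (matSmoothOn_rot i j)

/-- The generator G is skew, so differentiating RᵀVR at R = 1 gives the commutator VG - GV. -/
theorem hasDerivAt_act_rot {i j : Fin 4} (h : i ≠ j) {V w : SymMat}
    (hw : toMat w = toMat V * rotGen i j - rotGen i j * toMat V) :
    HasDerivAt (fun t => act (rotSO h t) V) w 0 := by
  apply HasMatDeriv.hasDerivAt
  simp only [toMat_act]
  have := ((hasMatDeriv_rot i j).transpose.mul (HasMatDeriv.const (toMat V))).mul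
    (hasMatDeriv_rot i j)
  have e : toMat w = ((rotGen i j)ᵀ * toMat V + (rot i j 0)ᵀ * 0) * rot i j 0 +
      (rot i j 0)ᵀ * toMat V * rotGen i j := by
    simp only [hw, rot_zero, Matrix.transpose_one, Matrix.one_mul, Matrix.mul_one, Matrix.mul_zero,
      add_zero, rotGen, Matrix.transpose_sub, Matrix.transpose_single, sub_mul]
    abel
  rw [e]
  exact this

/-- The commutator of diag(ν) with E_ij - E_ji is (ν_i - ν_j)(E_ij + E_ji). Used both for D and for
J, whose ratio of speeds is the principal curvature. -/
theorem hasDerivAt_act_rot_diagonal {i j : Fin 4} (h : i ≠ j) {V : SymMat} {ν : Fin 4 → ℝ}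
    (hV : toMat V = Matrix.diagonal ν) :
    HasDerivAt (fun t => act (rotSO h t) V) ((√2 * (ν i - ν j)) • Ehat i j) 0 := by
  apply hasDerivAt_act_rot
  have h3 : √2 ≠ (0 : ℝ) := by positivity
  rw [toMat_smul, toMat_Ehat h, hV, smul_smul, mul_assoc, mul_comm (ν i - ν j), ← mul_assoc,
    mul_one_div_cancel h3, one_mul, rotGen]
  ext k l
  simp only [Matrix.smul_apply, Matrix.add_apply, Matrix.sub_apply, Matrix.diagonal_mul,
    Matrix.mul_diagonal, Matrix.single_apply, smul_eq_mul]
  by_cases h1 : i = k ∧ j = l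
  · obtain ⟨rfl, rfl⟩ := h1
    simp [h]
  · by_cases h2 : j = k ∧ i = l
    · obtain ⟨rfl, rfl⟩ := h2
      simp [h]
      ring
    · simp [h1, h2]

/-- An operator which is diagonal in an orthogonal system has the expected eigenspaces. -/
theorem mem_span_and_eigen_iff {ι E : Type*} [Fintype ι] [NormedAddCommGroup E]
    [InnerProductSpace ℝ E] {e : ι → E} (hne : ∀ s, e s ≠ 0)
    (ho : Pairwise fun s t => ⟪e s, e t⟫ = 0) {L : E →L[ℝ] E} {k : ι → ℝ}
    (hL : ∀ s, -(L (e s)) = k s • e s) (c : ℝ) (v : E) :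
    (v ∈ Submodule.span ℝ (Set.range e) ∧ -(L v) = c • v) ↔
      v ∈ Submodule.span ℝ (e '' {s | k s = c}) := by
  constructor
  · rintro ⟨hv, hLv⟩
    obtain ⟨x, rfl⟩ := Submodule.mem_span_range_iff_exists_fun ℝ |>.1 hv
    -- An orthogonal system of nonzero vectors is independent, so each x s * (k s - c) vanishes:
    -- only directions with eigenvalue c survive.
    have h1 : ∑ s, (x s * (k s - c)) • e s = 0 := by
      have h2 : -(L (∑ s, x s • e s)) = ∑ s, (x s * k s) • e s := by
        rw [map_sum, ← Finset.sum_neg_distrib]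
        refine Finset.sum_congr rfl fun s _ => ?_
        rw [map_smul, ← smul_neg, hL, smul_smul]
      rw [h2, Finset.smul_sum] at hLv
      rw [← sub_eq_zero.2 hLv, ← Finset.sum_sub_distrib]
      refine Finset.sum_congr rfl fun s _ => ?_
      rw [smul_smul, ← sub_smul]
      congr 1
      ring
    have h3 := Fintype.linearIndependent_iff.1
      (linearIndependent_of_ne_zero_of_inner_eq_zero hne ho) _ h1
    refine Submodule.sum_mem _ fun s _ => ?_
    rcases mul_eq_zero.1 (h3 s) with h | h
    · simp [h]
    · exact Submodule.smul_mem _ _ (Submodule.subset_span ⟨s, sub_eq_zero.1 h, rfl⟩)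
  · intro hv
    refine ⟨Submodule.span_mono (Set.image_subset_range _ _) hv, ?_⟩
    induction hv using Submodule.span_induction with
    | mem x hx =>
      obtain ⟨s, hs, rfl⟩ := hx
      rw [hL, hs]
    | zero => simp
    | add x y _ _ hx hy => rw [map_add, neg_add, hx, hy, smul_add]
    | smul d x _ hx => rw [map_smul, ← smul_neg, hx, smul_comm]

theorem inner_smul_symMat (c : ℝ) (A B : SymMat) : ⟪c • A, B⟫ = c * ⟪A, B⟫ :=
  real_inner_smul_left A B c

/-! ### The normal field and the constraints -/

theorem contDiff_gradF3 : ContDiff ℝ ∞ gradF3 := by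
  rw [← contDiffOn_univ]
  apply contDiffOn_of_toMat
  simp only [toMat_gradF3]
  have h : MatSmoothOn toMat Set.univ := matSmoothOn_toMat contDiffOn_id
  exact MatSmoothOn.smul contDiffOn_const (((h.pow 2).sub (MatSmoothOn.smul
    ((h.pow 2).trace.div_const 4) (MatSmoothOn.const 1))).sub (MatSmoothOn.smul (h.pow 3).trace h))

theorem contDiffOn_unitNormal : ContDiffOn ℝ ∞ unitNormal {A | gradF3 A ≠ 0} := by
  have h1 : ContDiffOn ℝ ∞ rho {A | gradF3 A ≠ 0} :=
    contDiff_gradF3.contDiffOn.norm ℝ fun x hx => hx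
  exact ((h1.inv fun x hx => norm_ne_zero_iff.2 hx).smul contDiff_gradF3.contDiffOn).neg

theorem isOpen_gradF3_ne_zero : IsOpen {A | gradF3 A ≠ 0} :=
  isOpen_ne_fun contDiff_gradF3.continuous continuous_const

theorem gradF3_ne_zero {A : SymMat} (hA : A ∈ Btilde) : gradF3 A ≠ 0 := by
  obtain ⟨P, a, b, hb, hab, h, rfl⟩ := mem_Btilde_iff.1 hA
  have h1 : rho (act P (diagPt a b)) ≠ 0 := by
    rw [rho_act, rho_diagPt hb hab h]
    nlinarith
  exact norm_ne_zero_iff.1 h1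

theorem isSmoothOn_unitNormal : IsSmoothOn unitNormal Btilde :=
  IsSmoothOn.of_contDiffOn isOpen_gradF3_ne_zero contDiffOn_unitNormal
    (fun _ hA => gradF3_ne_zero hA) fun _ _ => rfl

theorem differentiableAt_unitNormal {A : SymMat} (hA : A ∈ Btilde) :
    DifferentiableAt ℝ unitNormal A :=
  (contDiffOn_unitNormal.contDiffAt (isOpen_gradF3_ne_zero.mem_nhds
    (gradF3_ne_zero hA))).differentiableAt (by simp)

theorem norm_eq_one_of_mem {A : SymMat} (hA : A ∈ Btilde) : ‖A‖ = 1 := by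
  obtain ⟨P, a, b, hb, hab, h, rfl⟩ := mem_Btilde_iff.1 hA
  rw [norm_act, (norm_diagPt_eq_one_iff a b).2 h]

theorem trace_cube_eq_zero_of_mem {A : SymMat} (hA : A ∈ Btilde) : (toMat A ^ 3).trace = 0 := by
  obtain ⟨P, a, b, hb, hab, h, rfl⟩ := mem_Btilde_iff.1 hA
  rw [toMat_act, conj_pow P.mul_transpose, trace_conj P.mul_transpose, trace_cube_diagPt]

theorem hasDerivAt_trace_cube {γ : ℝ → SymMat} {v : SymMat} (hγ : HasDerivAt γ v 0) :
    HasDerivAt (fun t => (toMat (γ t) ^ 3).trace)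
      (3 * (toMat (γ 0) ^ 2 * toMat v).trace) 0 := by
  have h1 := HasMatDeriv.of_hasDerivAt hγ
  have h2 := ((h1.mul h1).mul h1).trace
  simp only [pow_succ, pow_zero, Matrix.one_mul]
  refine h2.congr_deriv ?_
  set X := toMat (γ 0)
  set V := toMat v
  -- Cyclicity of the trace identifies the three terms of the product rule.
  rw [add_mul, Matrix.trace_add, Matrix.trace_add, Matrix.trace_mul_cycle V X X,
    Matrix.trace_mul_cycle X V X]
  ring

/-- Against a traceless vector orthogonal to A the terms in I and A drop out, leaving the
differential of tr A³. -/
theorem inner_gradF3 {A : SymMat} (v : SymMat) (h : ⟪A, v⟫ = 0) :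
    ⟪gradF3 A, v⟫ = 3 * (toMat A ^ 2 * toMat v).trace := by
  rw [inner_eq_trace_mul] at h ⊢
  rw [toMat_gradF3]
  simp only [Matrix.smul_mul, Matrix.sub_mul, Matrix.one_mul, Matrix.trace_smul, Matrix.trace_sub,
    h, trace_toMat, smul_eq_mul]
  ring

/-- Differentiating |γ|² = 1 and tr γ³ = 0 along curves in the hypersurface gives two linear
constraints, which bound the tangent space from above. -/
theorem inner_of_mem_tangentSpace {A v : SymMat} (hA : A ∈ Btilde)
    (hv : v ∈ tangentSpace Btilde A) : ⟪A, v⟫ = 0 ∧ ⟪gradF3 A, v⟫ = 0 := by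
  unfold tangentSpace at hv
  induction hv using Submodule.span_induction with
  | mem v hv =>
    obtain ⟨γ, -, rfl, hM, hd⟩ := hv
    have h1 : ⟪γ 0, v⟫ = 0 := by
      have h2 := hd.inner ℝ hd
      have h3 : HasDerivAt (fun t => ⟪γ t, γ t⟫) (0 : ℝ) 0 :=
        (hasDerivAt_const 0 (1 : ℝ)).congr_of_eventuallyEq <| hM.mono fun t ht => by
          simp [norm_eq_one_of_mem ht]
      have h4 := h2.unique h3
      linarith [real_inner_comm v (γ 0)]
    refine ⟨h1, ?_⟩
    rw [inner_gradF3 _ h1]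
    exact (hasDerivAt_trace_cube hd).unique <|
      (hasDerivAt_const 0 (0 : ℝ)).congr_of_eventuallyEq <| hM.mono fun t ht =>
        trace_cube_eq_zero_of_mem ht
  | zero => simp
  | add x y _ _ hx hy => simp [inner_add_right, hx, hy]
  | smul c x _ hx => simp [inner_smul_right, hx]

/-! ### The orthogonal frame at a diagonal matrix -/

/-- The frame `Ê i j`, `X₁` at `diag (a, -a, b, -b)`. -/
def frameAt (a b : ℝ) : Fin 7 → SymMat :=
  ![Ehat 0 1, Ehat 0 2, Ehat 0 3, Ehat 1 2, Ehat 1 3, Ehat 2 3, X1 (diagPt a b)]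

/-- The principal curvatures in the directions of the frame. -/
def curvAt (a b : ℝ) : Fin 7 → ℝ :=
  ![0, 1 / (a - b), 1 / (a + b), -(1 / (a + b)), -(1 / (a - b)), 0, 0]

/-- The coordinate planes belonging to the first six vectors of the frame. -/
def planeIdx : Fin 7 → Fin 4 × Fin 4 := ![(0, 1), (0, 2), (0, 3), (1, 2), (1, 3), (2, 3), (0, 1)]

/-- Index 6 belongs to X₁ and has no plane; its placeholder value (0, 1) keeps this valid for every
index. -/
theorem planeIdx_ne : ∀ s, (planeIdx s).1 ≠ (planeIdx s).2 := by decide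

theorem frameAt_eq_Ehat (a b : ℝ) {s : Fin 7} (hs : s ≠ 6) :
    frameAt a b s = Ehat (planeIdx s).1 (planeIdx s).2 := by
  fin_cases s
  all_goals first
    | exact absurd rfl hs
    | rfl

theorem X1_coeff_pos {a b : ℝ} (hb : 0 < b) (hab : b < a) : 0 < 2 * a * b * (a ^ 2 - b ^ 2) := by
  have : 0 < a := hb.trans hab
  have : 0 < a ^ 2 - b ^ 2 := by nlinarith
  positivity

theorem Ehat_ne_zero {i j : Fin 4} (h : i ≠ j) : Ehat i j ≠ 0 := by
  intro h0
  have h1 := congrFun (congrFun (congrArg toMat h0) i) j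
  rw [toMat_Ehat h] at h1
  simp [h.symm] at h1

theorem frameAt_ne_zero {a b : ℝ} (hb : 0 < b) (hab : b < a) (h : a ^ 2 + b ^ 2 = 1 / 2)
    (s : Fin 7) : frameAt a b s ≠ 0 := by
  have h6 : X1 (diagPt a b) ≠ 0 := by
    rw [X1_diagPt h]
    refine smul_ne_zero (X1_coeff_pos hb hab).ne' fun h0 => ?_
    have h1 := congrFun (congrFun (congrArg toMat h0) 0) 0
    simp at h1
    exact hb.ne' h1
  by_cases hs : s = 6
  · rw [hs]
    exact h6
  · rw [frameAt_eq_Ehat a b hs]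
    exact Ehat_ne_zero (planeIdx_ne s)

theorem inner_Ehat_Ehat {i j k l : Fin 4} (h : i ≠ j) (h' : k ≠ l) (h1 : ¬(i = k ∧ j = l))
    (h2 : ¬(i = l ∧ j = k)) : ⟪Ehat i j, Ehat k l⟫ = 0 := by
  rw [inner_Ehat _ h', toMat_Ehat h]
  have h2' : ¬(j = k ∧ i = l) := fun x => h2 x.symm
  simp only [Matrix.smul_apply, Matrix.add_apply, Matrix.single_apply, if_neg h1, if_neg h2']
  simp

theorem inner_X1_Ehat {a b : ℝ} (h : a ^ 2 + b ^ 2 = 1 / 2) {i j : Fin 4} (hij : i ≠ j) :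
    ⟪X1 (diagPt a b), Ehat i j⟫ = 0 := by
  rw [inner_Ehat _ hij, X1_diagPt h]
  simp [hij]

theorem frameAt_orthogonal {a b : ℝ} (h : a ^ 2 + b ^ 2 = 1 / 2) :
    Pairwise fun s t => ⟪frameAt a b s, frameAt a b t⟫ = 0 := by
  have idx : ∀ s t, s < t → t ≠ 6 →
      ¬((planeIdx t).1 = (planeIdx s).1 ∧ (planeIdx t).2 = (planeIdx s).2) ∧
      ¬((planeIdx t).1 = (planeIdx s).2 ∧ (planeIdx t).2 = (planeIdx s).1) := by decide
  have key : ∀ s t, s < t → ⟪frameAt a b t, frameAt a b s⟫ = 0 := by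
    intro s t hst
    rw [frameAt_eq_Ehat a b (ne_of_lt (hst.trans_le (Fin.le_last t)))]
    by_cases ht : t = 6
    · rw [ht]
      exact inner_X1_Ehat h (planeIdx_ne s)
    · rw [frameAt_eq_Ehat a b ht]
      exact inner_Ehat_Ehat (planeIdx_ne t) (planeIdx_ne s) (idx s t hst ht).1 (idx s t hst ht).2
  intro s t hst
  rcases lt_or_gt_of_ne hst with h1 | h1
  · rw [real_inner_comm]; exact key s t h1
  · exact key t s h1

/-- Off the diagonal the coefficients are read off directly. The trace and the orthogonality to J
make the diagonal diag(x, -x, y, -y), and orthogonality to D makes it a multiple of diag(b, -b, -a,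
a), with factor (bx - ay)/(a² + b²) = 2(bx - ay). -/
theorem eq_frame_combination {a b : ℝ} (hb : 0 < b) (hab : b < a) (h : a ^ 2 + b ^ 2 = 1 / 2)
    {w : SymMat} (h1 : ⟪w, diagPt a b⟫ = 0) (h2 : ⟪w, diagJ⟫ = 0) :
    w = (√2 * toMat w 0 1) • Ehat 0 1 + (√2 * toMat w 0 2) • Ehat 0 2 +
      (√2 * toMat w 0 3) • Ehat 0 3 + (√2 * toMat w 1 2) • Ehat 1 2 +
      (√2 * toMat w 1 3) • Ehat 1 3 + (√2 * toMat w 2 3) • Ehat 2 3 +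
      (2 * (b * toMat w 0 0 - a * toMat w 2 2) / (2 * a * b * (a ^ 2 - b ^ 2))) •
        X1 (diagPt a b) := by
  have hc := (X1_coeff_pos hb hab).ne'
  have hs : √2 * (√2)⁻¹ = (1 : ℝ) := mul_inv_cancel₀ (by positivity)
  rw [X1_diagPt h, smul_smul, div_mul_cancel₀ _ hc]
  rw [inner_diagonal _ (toMat_diagPt a b)] at h1
  rw [inner_diagonal _ toMat_diagJ] at h2
  have h3 := trace_toMat w
  simp only [Matrix.trace, Matrix.diag, Fin.sum_univ_four] at h1 h2 h3
  simp at h1 h2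
  have e1 : toMat w 1 1 = -toMat w 0 0 := by linarith
  have e3 : toMat w 3 3 = -toMat w 2 2 := by linarith
  have e4 : a * toMat w 0 0 + b * toMat w 2 2 = 0 := by
    rw [e1, e3] at h1
    linarith
  have e5 : 2 * (b * toMat w 0 0 - a * toMat w 2 2) * b = toMat w 0 0 := by
    linear_combination (-2 * a) * e4 + 2 * toMat w 0 0 * h
  have e6 : 2 * (b * toMat w 0 0 - a * toMat w 2 2) * a = -toMat w 2 2 := by
    linear_combination (2 * b) * e4 - 2 * toMat w 2 2 * h
  have hs' : ∀ x : ℝ, x = √2 * x * (√2)⁻¹ := fun x => by linear_combination (-x) * hs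
  have key : ∀ w' : SymMat, (∀ i j, i ≤ j → toMat w i j = toMat w' i j) → w = w' := by
    intro w' hw
    apply toMat_injective
    ext i j
    rcases le_total i j with hij | hij
    · exact hw i j hij
    · rw [toMat_symm w, toMat_symm w']
      exact hw j i hij
  apply key
  intro i j hij
  simp only [toMat_add, toMat_smul]
  rw [toMat_Ehat (by decide), toMat_Ehat (by decide), toMat_Ehat (by decide),
    toMat_Ehat (by decide), toMat_Ehat (by decide), toMat_Ehat (by decide), toMat_diagPt]
  fin_cases i <;> fin_cases j <;> first
    | exact absurd hij (by decide)
    | (simp; first | exact hs' _ | linarith)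

theorem mem_span_frameAt {a b : ℝ} (hb : 0 < b) (hab : b < a) (h : a ^ 2 + b ^ 2 = 1 / 2)
    {w : SymMat} (h1 : ⟪w, diagPt a b⟫ = 0) (h2 : ⟪w, diagJ⟫ = 0) :
    w ∈ Submodule.span ℝ (Set.range (frameAt a b)) := by
  have hm : ∀ s, frameAt a b s ∈ Submodule.span ℝ (Set.range (frameAt a b)) :=
    fun s => Submodule.subset_span ⟨s, rfl⟩
  rw [eq_frame_combination hb hab h h1 h2]
  exact add_mem (add_mem (add_mem (add_mem (add_mem (add_mem
    (Submodule.smul_mem _ _ (hm 0)) (Submodule.smul_mem _ _ (hm 1)))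
    (Submodule.smul_mem _ _ (hm 2))) (Submodule.smul_mem _ _ (hm 3)))
    (Submodule.smul_mem _ _ (hm 4))) (Submodule.smul_mem _ _ (hm 5)))
    (Submodule.smul_mem _ _ (hm 6))

/-! ### Curves in the hypersurface -/

theorem act_rotSO_mul_mem {P : SO4} {a b : ℝ} (hb : 0 < b) (hab : b < a)
    (h : a ^ 2 + b ^ 2 = 1 / 2) {i j : Fin 4} (hij : i ≠ j) (t : ℝ) :
    act P (act (rotSO hij t) (diagPt a b)) ∈ Btilde :=
  mem_Btilde_iff.2 ⟨rotSO hij t * P, a, b, hb, hab, h, (act_mul _ _ _).symm⟩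

/-- By equivariance the normal along the rotated curve is the rotated -J/2. Both velocities are
multiples of Ê_ij, and `hk` says that their ratio is -k, making k the principal curvature. -/
theorem exists_curve_rot (P : SO4) {a b : ℝ} (hb : 0 < b) (hab : b < a)
    (h : a ^ 2 + b ^ 2 = 1 / 2) {i j : Fin 4} (hij : i ≠ j) {k : ℝ}
    (hμ : (![a, -a, b, -b] i - ![a, -a, b, -b] j : ℝ) ≠ 0)
    (hk : (1 / 2 : ℝ) * (![1, 1, -1, -1] i - ![1, 1, -1, -1] j) =
      k * (![a, -a, b, -b] i - ![a, -a, b, -b] j)) :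
    ∃ (c : ℝ) (γ : ℝ → SymMat), c ≠ 0 ∧ ContDiff ℝ ∞ γ ∧ γ 0 = act P (diagPt a b) ∧
      (∀ᶠ t in 𝓝 (0 : ℝ), γ t ∈ Btilde) ∧ HasDerivAt γ (c • act P (Ehat i j)) 0 ∧
      HasDerivAt (fun t => unitNormal (γ t)) (-((c * k) • act P (Ehat i j))) 0 := by
  refine ⟨√2 * (![a, -a, b, -b] i - ![a, -a, b, -b] j),
    fun t => act P (act (rotSO hij t) (diagPt a b)), mul_ne_zero (by positivity) hμ,
    (actL P).contDiff.comp (contDiff_act_rot hij _), by simp [rotSO_zero],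
    Filter.Eventually.of_forall fun t => act_rotSO_mul_mem hb hab h hij t, ?_, ?_⟩
  · have := (actL P).hasFDerivAt.comp_hasDerivAt 0
      (hasDerivAt_act_rot_diagonal hij (toMat_diagPt a b))
    exact this.congr_deriv (act_smul _ _ _)
  · have h1 := ((actL P).hasFDerivAt.comp_hasDerivAt 0
      (hasDerivAt_act_rot_diagonal hij toMat_diagJ)).const_smul (-(1 / 2) : ℝ)
    have h2 : (fun t => unitNormal (act P (act (rotSO hij t) (diagPt a b)))) =
        (-(1 / 2) : ℝ) • (actL P ∘ fun t => act (rotSO hij t) diagJ) := by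
      ext1 t
      rw [unitNormal_act, unitNormal_act, unitNormal_diagPt hb hab h, act_smul, act_smul]
      rfl
    rw [h2]
    refine h1.congr_deriv ?_
    rw [actL_apply, act_smul, smul_smul, ← neg_smul]
    congr 1
    linear_combination (-√2) * hk

/-- The great circle through D inside the diagonal plane keeps the shape diag(a', -a', b', -b'), and
0 < b' < a' persists for small t. The normal -J/2 is constant along it, hence curvature 0. The
constant c rescales X₁ to the unit-speed velocity -diag(b, -b, -a, a) up to the norm of D. -/
theorem exists_curve_diag (P : SO4) {a b : ℝ} (hb : 0 < b) (hab : b < a)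
    (h : a ^ 2 + b ^ 2 = 1 / 2) :
    ∃ (c : ℝ) (γ : ℝ → SymMat), c ≠ 0 ∧ ContDiff ℝ ∞ γ ∧ γ 0 = act P (diagPt a b) ∧
      (∀ᶠ t in 𝓝 (0 : ℝ), γ t ∈ Btilde) ∧ HasDerivAt γ (c • act P (X1 (diagPt a b))) 0 ∧
      HasDerivAt (fun t => unitNormal (γ t)) (-((c * 0) • act P (X1 (diagPt a b)))) 0 := by
  have hc := X1_coeff_pos hb hab
  have heq : ∀ t : ℝ, Real.cos t • diagPt a b - Real.sin t • diagPt b (-a) =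
      diagPt (a * Real.cos t - b * Real.sin t) (b * Real.cos t + a * Real.sin t) := by
    intro t
    apply toMat_injective
    ext i j
    by_cases hij : i = j
    · subst hij
      fin_cases i <;> simp <;> ring
    · simp [hij]
  have hev : ∀ᶠ t in 𝓝 (0 : ℝ), 0 < b * Real.cos t + a * Real.sin t ∧
      b * Real.cos t + a * Real.sin t < a * Real.cos t - b * Real.sin t := by
    have c1 : Continuous fun t : ℝ => b * Real.cos t + a * Real.sin t := by fun_prop
    have c2 : Continuous fun t : ℝ => a * Real.cos t - b * Real.sin t := by fun_prop
    exact (c1.continuousAt.eventually_const_lt (by simpa using hb)).and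
      (c1.continuousAt.eventually_lt c2.continuousAt (by simpa using hab))
  have hnorm : ∀ t : ℝ, (a * Real.cos t - b * Real.sin t) ^ 2 +
      (b * Real.cos t + a * Real.sin t) ^ 2 = 1 / 2 := fun t => by
    linear_combination h + (a ^ 2 + b ^ 2) * Real.sin_sq_add_cos_sq t
  refine ⟨-(1 / (2 * a * b * (a ^ 2 - b ^ 2))),
    fun t => act P (Real.cos t • diagPt a b - Real.sin t • diagPt b (-a)),
    neg_ne_zero.2 (one_div_ne_zero hc.ne'), (actL P).contDiff.comp
      ((Real.contDiff_cos.smul contDiff_const).sub (Real.contDiff_sin.smul contDiff_const)),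
    by simp, ?_, ?_, ?_⟩
  · filter_upwards [hev] with t ht
    exact mem_Btilde_iff.2 ⟨P, _, _, ht.1, ht.2, hnorm t, by rw [heq]⟩
  · have h1 := (actL P).hasFDerivAt.comp_hasDerivAt 0
      (((Real.hasDerivAt_cos 0).smul_const (diagPt a b)).sub
        ((Real.hasDerivAt_sin 0).smul_const (diagPt b (-a))))
    refine h1.congr_deriv ?_
    rw [X1_diagPt h, act_smul, smul_smul, neg_mul, one_div_mul_cancel hc.ne']
    simp [act_neg]
  · rw [mul_zero, zero_smul, neg_zero]
    refine (hasDerivAt_const 0 (act P ((-(1 / 2) : ℝ) • diagJ))).congr_of_eventuallyEq ?_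
    filter_upwards [hev] with t ht
    rw [unitNormal_act, heq, unitNormal_diagPt ht.1 ht.2 (hnorm t)]

theorem exists_curve (P : SO4) {a b : ℝ} (hb : 0 < b) (hab : b < a)
    (h : a ^ 2 + b ^ 2 = 1 / 2) (s : Fin 7) :
    ∃ (c : ℝ) (γ : ℝ → SymMat), c ≠ 0 ∧ ContDiff ℝ ∞ γ ∧ γ 0 = act P (diagPt a b) ∧
      (∀ᶠ t in 𝓝 (0 : ℝ), γ t ∈ Btilde) ∧ HasDerivAt γ (c • act P (frameAt a b s)) 0 ∧
      HasDerivAt (fun t => unitNormal (γ t)) (-((c * curvAt a b s) • act P (frameAt a b s))) 0 := by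
  have h1 : a - b ≠ 0 := (sub_pos.2 hab).ne'
  have h2 : a + b ≠ 0 := by linarith
  have h3 : -a - b ≠ 0 := by intro h; apply h2; linarith
  have h4 : -a + b ≠ 0 := by intro h; apply h1; linarith
  have h5 : a ≠ 0 := (hb.trans hab).ne'
  have h6 : b ≠ 0 := hb.ne'
  fin_cases s
  · exact exists_curve_rot P hb hab h (i := 0) (j := 1) (by decide) (by simpa) (by simp [curvAt])
  · exact exists_curve_rot P hb hab h (i := 0) (j := 2) (by decide) (by simpa)
      (by simp [curvAt]; field_simp; norm_num)
  · exact exists_curve_rot P hb hab h (i := 0) (j := 3) (by decide) (by simpa)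
      (by simp [curvAt]; field_simp; norm_num)
  · exact exists_curve_rot P hb hab h (i := 1) (j := 2) (by decide) (by simpa)
      (by simp [curvAt]; field_simp; ring)
  · exact exists_curve_rot P hb hab h (i := 1) (j := 3) (by decide) (by simpa)
      (by simp [curvAt]; field_simp; ring)
  · exact exists_curve_rot P hb hab h (i := 2) (j := 3) (by decide) (by simpa) (by simp [curvAt])
  · exact exists_curve_diag P hb hab h

/-! ### Tangent spaces and the shape operator -/

theorem act_frameAt_mem_tangentSpace (P : SO4) {a b : ℝ} (hb : 0 < b) (hab : b < a)
    (h : a ^ 2 + b ^ 2 = 1 / 2) (s : Fin 7) :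
    act P (frameAt a b s) ∈ tangentSpace Btilde (act P (diagPt a b)) := by
  obtain ⟨c, γ, hc, hγ, h0, hM, hd, -⟩ := exists_curve P hb hab h s
  have h1 : c • act P (frameAt a b s) ∈ tangentSpace Btilde (act P (diagPt a b)) :=
    Submodule.subset_span ⟨γ, hγ, h0, hM, hd⟩
  exact (Submodule.smul_mem_iff _ hc).1 h1

/-- One inclusion comes from the two linear constraints, pulled back by P⁻¹ to the diagonal point;
the other from the explicit curves. -/
theorem tangentSpace_act_diagPt (P : SO4) {a b : ℝ} (hb : 0 < b) (hab : b < a)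
    (h : a ^ 2 + b ^ 2 = 1 / 2) : tangentSpace Btilde (act P (diagPt a b)) =
      Submodule.span ℝ (Set.range fun s => act P (frameAt a b s)) := by
  apply le_antisymm
  · intro v hv
    have hA : act P (diagPt a b) ∈ Btilde := mem_Btilde_iff.2 ⟨P, a, b, hb, hab, h, rfl⟩
    obtain ⟨h1, h2⟩ := inner_of_mem_tangentSpace hA hv
    rw [← act_act_inv P v] at h1 h2 ⊢
    have h3 : 3 * (a ^ 2 - b ^ 2) / 2 ≠ 0 := by
      have : 0 < a ^ 2 - b ^ 2 := by nlinarith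
      positivity
    rw [gradF3_act, inner_act_act, gradF3_diagPt h, inner_smul_symMat, mul_eq_zero] at h2
    rw [inner_act_act, real_inner_comm] at h1
    have h4 := mem_span_frameAt hb hab h h1
      (by rw [real_inner_comm]; exact h2.resolve_left h3)
    have h5 := Submodule.mem_map_of_mem (f := (actL P : SymMat →ₗ[ℝ] SymMat)) h4
    rw [Submodule.map_span, ← Set.range_comp] at h5
    exact h5
  · rw [Submodule.span_le]
    rintro _ ⟨s, rfl⟩
    exact act_frameAt_mem_tangentSpace P hb hab h s

theorem fderivWithin_unitNormal_frame (P : SO4) {a b : ℝ} (hb : 0 < b) (hab : b < a)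
    (h : a ^ 2 + b ^ 2 = 1 / 2) (s : Fin 7) :
    -(fderivWithin ℝ unitNormal Btilde (act P (diagPt a b)) (act P (frameAt a b s))) =
      curvAt a b s • act P (frameAt a b s) := by
  obtain ⟨c, γ, hc, hγ, h0, hM, hd, hu⟩ := exists_curve P hb hab h s
  have hA : act P (diagPt a b) ∈ Btilde := mem_Btilde_iff.2 ⟨P, a, b, hb, hab, h, rfl⟩
  have h1 := fderivWithin_apply_of_curve (isSmoothOn_unitNormal.differentiableWithinAt hA) h0 hd
    hM hu
  rw [map_smul, mul_smul, ← smul_neg] at h1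
  rw [smul_right_injective _ hc h1, neg_neg]

theorem principalSpace_act_diagPt (P : SO4) {a b : ℝ} (hb : 0 < b) (hab : b < a)
    (h : a ^ 2 + b ^ 2 = 1 / 2) (c : ℝ) :
    principalSpace Btilde unitNormal (act P (diagPt a b)) c =
      Submodule.span ℝ ((fun s => act P (frameAt a b s)) '' {s | curvAt a b s = c}) := by
  ext v
  rw [← mem_span_and_eigen_iff (k := curvAt a b) ?_ ?_ (fderivWithin_unitNormal_frame P hb hab h),
    ← tangentSpace_act_diagPt P hb hab h]
  · rfl
  · intro s h0
    refine frameAt_ne_zero hb hab h s (norm_eq_zero.1 ?_)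
    rw [← norm_act P, h0, norm_zero]
  · intro s t hst
    rw [inner_act_act]
    exact frameAt_orthogonal h hst

/-! ### The unit normal field -/

theorem inner_diagPt_diagJ (a b : ℝ) : ⟪diagPt a b, diagJ⟫ = 0 := by
  rw [inner_diagonal _ toMat_diagJ, toMat_diagPt]
  simp [Fin.sum_univ_four]

theorem norm_unitNormal {A : SymMat} (hA : A ∈ Btilde) : ‖unitNormal A‖ = 1 := by
  rw [unitNormal, norm_neg, norm_smul, rho, norm_inv, norm_norm]
  exact inv_mul_cancel₀ (norm_ne_zero_iff.2 (gradF3_ne_zero hA))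

theorem inner_gradF3_self {A : SymMat} (hA : A ∈ Btilde) : ⟪A, gradF3 A⟫ = 0 := by
  obtain ⟨P, a, b, hb, hab, h, rfl⟩ := mem_Btilde_iff.1 hA
  rw [gradF3_act, inner_act_act, gradF3_diagPt h, real_inner_comm, inner_smul_symMat,
    real_inner_comm, inner_diagPt_diagJ, mul_zero]

theorem inner_unitNormal (A v : SymMat) : ⟪v, unitNormal A⟫ = -((rho A)⁻¹ * ⟪gradF3 A, v⟫) := by
  rw [real_inner_comm, unitNormal, inner_neg_left, inner_smul_symMat]

theorem isUnitNormal_unitNormal : IsUnitNormal Btilde unitNormal := by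
  refine ⟨isSmoothOn_unitNormal, fun A hA => ⟨norm_unitNormal hA, ?_, fun v hv => ?_⟩⟩
  · rw [inner_unitNormal, real_inner_comm, inner_gradF3_self hA, mul_zero, neg_zero]
  · rw [inner_unitNormal, (inner_of_mem_tangentSpace hA hv).2, mul_zero, neg_zero]

/-! ### Diagonalization, and the equations of the hypersurface -/

/-- `X` is orthogonally diagonalizable with the eigenvalues `ν`, in this order. -/
def HasDiagonalization (X : Matrix (Fin 4) (Fin 4) ℝ) (ν : Fin 4 → ℝ) : Prop :=
  ∃ O : Matrix (Fin 4) (Fin 4) ℝ, O * Oᵀ = 1 ∧ X = Oᵀ * Matrix.diagonal ν * O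

theorem HasDiagonalization.perm {X : Matrix (Fin 4) (Fin 4) ℝ} {ν : Fin 4 → ℝ}
    (h : HasDiagonalization X ν) (σ : Equiv.Perm (Fin 4)) : HasDiagonalization X (ν ∘ σ) := by
  obtain ⟨O, hO, rfl⟩ := h
  refine ⟨O.submatrix σ id, ?_, ?_⟩
  · ext k l
    have h1 := congrFun (congrFun hO (σ k)) (σ l)
    simp only [Matrix.mul_apply, Matrix.transpose_apply, Matrix.submatrix_apply, id_eq,
      Matrix.one_apply, σ.injective.eq_iff] at h1 ⊢
    exact h1
  · ext i j
    rw [Matrix.mul_apply, Matrix.mul_apply]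
    simp only [Matrix.mul_diagonal, Matrix.transpose_apply,
      Matrix.submatrix_apply, id_eq, Function.comp_apply]
    exact (Equiv.sum_comp σ fun k => O k i * ν k * O k j).symm

theorem HasDiagonalization.exists_SO4 {X : Matrix (Fin 4) (Fin 4) ℝ} {ν : Fin 4 → ℝ}
    (h : HasDiagonalization X ν) : ∃ P : SO4, X = P.1ᵀ * Matrix.diagonal ν * P.1 := by
  obtain ⟨O, hO, rfl⟩ := h
  have hdet : O.det * O.det = 1 := by simpa using congrArg Matrix.det hO
  rcases mul_self_eq_one_iff.1 hdet with h1 | h1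
  · exact ⟨⟨O, mem_SO4 hO h1⟩, rfl⟩
  -- If det O = -1, negate the first row. The reflection R commutes with diagonal matrices, so the
  -- conjugate is unchanged.
  · set R : Matrix (Fin 4) (Fin 4) ℝ := Matrix.diagonal ![-1, 1, 1, 1] with hR
    have hRR : R * R = 1 := by
      rw [hR, Matrix.diagonal_mul_diagonal, ← Matrix.diagonal_one]
      congr 1
      ext i
      fin_cases i <;> simp
    have hRt : Rᵀ = R := Matrix.diagonal_transpose _
    refine ⟨⟨R * O, mem_SO4 ?_ ?_⟩, ?_⟩
    · rw [Matrix.transpose_mul, hRt, Matrix.mul_assoc, ← Matrix.mul_assoc O, hO, Matrix.one_mul, hRR]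
    · rw [Matrix.det_mul, h1, hR, Matrix.det_diagonal]
      simp [Fin.prod_univ_four]
    · have hcomm : R * Matrix.diagonal ν * R = Matrix.diagonal ν := by
        rw [hR, Matrix.diagonal_mul_diagonal, Matrix.diagonal_mul_diagonal]
        congr 1
        ext i
        fin_cases i <;> simp
      change _ = (R * O)ᵀ * Matrix.diagonal ν * (R * O)
      calc Oᵀ * Matrix.diagonal ν * O = Oᵀ * (R * Matrix.diagonal ν * R) * O := by rw [hcomm]
        _ = _ := by simp only [Matrix.transpose_mul, hRt, Matrix.mul_assoc]

theorem exists_hasDiagonalization (A : SymMat) : ∃ ν, HasDiagonalization (toMat A) ν := by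
  have hA : (toMat A).IsHermitian := by
    rw [Matrix.IsHermitian, Matrix.conjTranspose_eq_transpose_of_trivial, toMat_transpose]
  refine ⟨hA.eigenvalues, (hA.eigenvectorUnitary : Matrix (Fin 4) (Fin 4) ℝ)ᵀ, ?_, ?_⟩
  · have := (Matrix.mem_unitaryGroup_iff'.1 hA.eigenvectorUnitary.2)
    rw [Matrix.transpose_transpose]
    simpa [Matrix.star_eq_conjTranspose] using this
  · have := hA.spectral_theorem
    rw [Matrix.transpose_transpose]
    conv_lhs => rw [this]
    simp [Matrix.star_eq_conjTranspose, Unitary.conjStarAlgAut_apply]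

theorem exists_diagPt_of_trace_cube {A : SymMat} (h3 : (toMat A ^ 3).trace = 0) :
    ∃ (P : SO4) (a b : ℝ), 0 ≤ b ∧ b ≤ a ∧ A = act P (diagPt a b) := by
  obtain ⟨ν, hν⟩ := exists_hasDiagonalization A
  have e1 : ν 0 + ν 1 + ν 2 + ν 3 = 0 := by
    obtain ⟨O, hO, hX⟩ := hν
    have := trace_toMat A
    rwa [hX, trace_conj hO, Matrix.trace_diagonal, Fin.sum_univ_four] at this
  have e3 : ν 0 ^ 3 + ν 1 ^ 3 + ν 2 ^ 3 + ν 3 ^ 3 = 0 := by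
    obtain ⟨O, hO, hX⟩ := hν
    rw [hX, conj_pow hO, trace_conj hO, Matrix.diagonal_pow, Matrix.trace_diagonal,
      Fin.sum_univ_four] at h3
    exact h3
  have s01 : ∀ p q r s, HasDiagonalization (toMat A) ![p, q, r, s] →
      HasDiagonalization (toMat A) ![q, p, r, s] := fun p q r s h => by
    convert h.perm (Equiv.swap 0 1) using 1
    ext i; fin_cases i <;> rfl
  have s02 : ∀ p q r s, HasDiagonalization (toMat A) ![p, q, r, s] →
      HasDiagonalization (toMat A) ![r, q, p, s] := fun p q r s h => by
    convert h.perm (Equiv.swap 0 2) using 1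
    ext i; fin_cases i <;> rfl
  have s13 : ∀ p q r s, HasDiagonalization (toMat A) ![p, q, r, s] →
      HasDiagonalization (toMat A) ![p, s, r, q] := fun p q r s h => by
    convert h.perm (Equiv.swap 1 3) using 1
    ext i; fin_cases i <;> rfl
  have h0 : HasDiagonalization (toMat A) ![ν 0, ν 1, ν 2, ν 3] := by
    convert hν using 1
    ext i; fin_cases i <;> rfl
  have ex : ∃ a b, HasDiagonalization (toMat A) ![a, -a, b, -b] := by
    -- With ν 3 = -(ν 0 + ν 1 + ν 2), the sum of cubes is -3 times this product; each vanishing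
    -- factor pairs off the eigenvalues.
    have hprod : (ν 0 + ν 1) * ((ν 0 + ν 2) * (ν 1 + ν 2)) = 0 := by
      have : ν 3 = -(ν 0 + ν 1 + ν 2) := by linarith
      rw [this] at e3
      linear_combination (-1 / 3 : ℝ) * e3
    rcases mul_eq_zero.1 hprod with h | h
    · refine ⟨ν 0, ν 2, ?_⟩
      rwa [show -ν 0 = ν 1 by linarith, show -ν 2 = ν 3 by linarith]
    rcases mul_eq_zero.1 h with h | h
    · refine ⟨ν 2, ν 1, ?_⟩
      rw [show -ν 2 = ν 0 by linarith, show -ν 1 = ν 3 by linarith]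
      exact s01 _ _ _ _ (s02 _ _ _ _ (s01 _ _ _ _ (s02 _ _ _ _ h0)))
    · refine ⟨ν 2, ν 0, ?_⟩
      rw [show -ν 2 = ν 1 by linarith, show -ν 0 = ν 3 by linarith]
      exact s02 _ _ _ _ h0
  have swap : ∀ a b, HasDiagonalization (toMat A) ![a, -a, b, -b] →
      HasDiagonalization (toMat A) ![b, -b, a, -a] := fun a b h =>
    s13 _ _ _ _ (s02 _ _ _ _ h)
  have neg : ∀ a b, HasDiagonalization (toMat A) ![a, -a, b, -b] →
      HasDiagonalization (toMat A) ![|a|, -|a|, b, -b] := fun a b h => by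
    rcases abs_cases a with ⟨e, -⟩ | ⟨e, -⟩
    · rwa [e]
    · rw [e, neg_neg]
      exact s01 _ _ _ _ h
  obtain ⟨a, b, h⟩ := ex
  rcases le_total |b| |a| with hab | hab
  · obtain ⟨P, hP⟩ := (swap _ _ (neg _ _ (swap _ _ (neg _ _ h)))).exists_SO4
    exact ⟨P, |a|, |b|, abs_nonneg _, hab, toMat_injective (by rw [hP, toMat_act, toMat_diagPt])⟩
  · obtain ⟨P, hP⟩ := (neg _ _ (swap _ _ (neg _ _ h))).exists_SO4
    exact ⟨P, |b|, |a|, abs_nonneg _, hab, toMat_injective (by rw [hP, toMat_act, toMat_diagPt])⟩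

/-- The open set on which the eigenvalues `a > b > 0` of the points of the hypersurface are smooth
functions of the determinant. -/
def detRange : Set SymMat := {A | 0 < (toMat A).det ∧ (toMat A).det < 1 / 16}

theorem contDiff_det : ContDiff ℝ ∞ fun A : SymMat => (toMat A).det := by
  rw [← contDiffOn_univ]
  exact (matSmoothOn_toMat contDiffOn_id).det

theorem isOpen_detRange : IsOpen detRange :=
  (isOpen_lt continuous_const contDiff_det.continuous).inter
    (isOpen_lt contDiff_det.continuous continuous_const)

theorem det_act (P : SO4) (A : SymMat) : (toMat (act P A)).det = (toMat A).det := by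
  rw [toMat_act, det_conj P.mul_transpose]

/-- Under a² + b² = 1/2 one has 1/16 - a²b² = (a² - b²)²/4, which is positive because a ≠ b. -/
theorem Btilde_subset_detRange : Btilde ⊆ detRange := by
  intro A hA
  obtain ⟨P, a, b, hb, hab, h, rfl⟩ := mem_Btilde_iff.1 hA
  have ha := hb.trans hab
  have h1 : 0 < a ^ 2 - b ^ 2 := by nlinarith
  simp only [detRange, Set.mem_ofPred_eq, det_act, det_diagPt]
  refine ⟨by positivity, ?_⟩
  have h2 : (a ^ 2 + b ^ 2) ^ 2 = 1 / 4 := by rw [h]; norm_num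
  nlinarith [mul_pos h1 h1]

theorem mem_Btilde_of_equations {A : SymMat} (hA : ‖A‖ = 1) (h : A ∈ detRange)
    (h3 : (toMat A ^ 3).trace = 0) : A ∈ Btilde := by
  obtain ⟨P, a, b, hb, hab, rfl⟩ := exists_diagPt_of_trace_cube h3
  rw [norm_act, norm_diagPt_eq_one_iff] at hA
  simp only [detRange, Set.mem_ofPred_eq, det_act, det_diagPt] at h
  refine mem_Btilde_iff.2 ⟨P, a, b, hb.lt_of_ne ?_, hab.lt_of_ne ?_, hA, rfl⟩
  · rintro rfl
    simp at h
  · rintro rfl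
    have h4 : b ^ 2 = 1 / 4 := by linarith
    rw [h4] at h
    norm_num at h

theorem contDiff_trace_cube : ContDiff ℝ ∞ fun A : SymMat => (toMat A ^ 3).trace := by
  rw [← contDiffOn_univ]
  exact ((matSmoothOn_toMat contDiffOn_id).pow 3).trace

theorem isSphereHypersurface_Btilde : IsSphereHypersurface Btilde := by
  refine ⟨fun p hp => norm_eq_one_of_mem hp, fun p hp => ⟨detRange, fun A => (toMat A ^ 3).trace,
    isOpen_detRange, Btilde_subset_detRange hp, contDiff_trace_cube.contDiffOn, fun x hx h1 =>
    ⟨trace_cube_eq_zero_of_mem, mem_Btilde_of_equations h1 hx⟩, gradF3 p, inner_gradF3_self hp, ?_⟩⟩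
  -- In the direction of the gradient itself the derivative of tr A³ is |gradF3 p|², which is
  -- nonzero.
  have h1 : HasDerivAt (fun t : ℝ => p + t • gradF3 p) (gradF3 p) 0 := by
    simpa using ((hasDerivAt_id (0 : ℝ)).smul_const (gradF3 p)).const_add p
  have h2 : HasFDerivAt (fun A : SymMat => (toMat A ^ 3).trace) _ p :=
    (contDiff_trace_cube.differentiable (by simp) p).hasFDerivAt
  have h3 := h2.comp_hasDerivAt_of_eq 0 h1 (by simp)
  have h4 := h3.unique (hasDerivAt_trace_cube h1)
  rw [h4, zero_smul, add_zero, ← inner_gradF3 _ (inner_gradF3_self hp)]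
  exact inner_self_ne_zero.2 (gradF3_ne_zero hp)

/-! ### The principal curvatures -/

/-- The principal curvature functions. -/
def kappa : Fin 5 → SymMat → ℝ :=
  ![fun A => (√(1 / 2 - 2 * √(toMat A).det))⁻¹, fun A => -(√(1 / 2 - 2 * √(toMat A).det))⁻¹,
    fun A => (√(1 / 2 + 2 * √(toMat A).det))⁻¹, fun A => -(√(1 / 2 + 2 * √(toMat A).det))⁻¹,
    fun _ => 0]

theorem contDiffOn_sqrt_det : ContDiffOn ℝ ∞ (fun A : SymMat => √(toMat A).det) detRange :=
  contDiff_det.contDiffOn.sqrt fun _ hA => hA.1.ne'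

theorem sqrt_det_lt {A : SymMat} (hA : A ∈ detRange) : 0 < 1 / 2 - 2 * √(toMat A).det := by
  have : √(toMat A).det < 1 / 4 := by
    rw [Real.sqrt_lt' (by norm_num)]
    exact hA.2.trans_eq (by norm_num)
  linarith

theorem contDiffOn_sqrt_sub :
    ContDiffOn ℝ ∞ (fun A : SymMat => √(1 / 2 - 2 * √(toMat A).det)) detRange :=
  (contDiffOn_const.sub (contDiffOn_const.mul contDiffOn_sqrt_det)).sqrt
    fun _ hA => (sqrt_det_lt hA).ne'

theorem contDiffOn_sqrt_add :
    ContDiffOn ℝ ∞ (fun A : SymMat => √(1 / 2 + 2 * √(toMat A).det)) detRange :=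
  (contDiffOn_const.add (contDiffOn_const.mul contDiffOn_sqrt_det)).sqrt
    fun _ _ => by positivity

theorem isSmoothOn_kappa (i : Fin 5) : IsSmoothOn (kappa i) Btilde := by
  have h1 := contDiffOn_sqrt_sub.inv fun A hA => (Real.sqrt_pos.2 (sqrt_det_lt hA)).ne'
  have h2 := contDiffOn_sqrt_add.inv fun A hA => (Real.sqrt_pos.2 (by positivity)).ne'
  have h : ContDiffOn ℝ ∞ (kappa i) detRange := by
    fin_cases i
    exacts [h1, h1.neg, h2, h2.neg, contDiffOn_const]
  exact IsSmoothOn.of_contDiffOn isOpen_detRange h Btilde_subset_detRange fun _ _ => rfl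

theorem sqrt_det_act_diagPt (P : SO4) {a b : ℝ} (hb : 0 < b) (hab : b < a) :
    √(toMat (act P (diagPt a b))).det = a * b := by
  rw [det_act, det_diagPt, ← mul_pow, Real.sqrt_sq (mul_pos (hb.trans hab) hb).le]

/-- Since (a ∓ b)² = 1/2 ∓ 2ab and ab = √det, both a - b and a + b, hence all principal curvatures
and eigenvalues, depend on det alone. -/
theorem sqrt_sub_act_diagPt (P : SO4) {a b : ℝ} (hb : 0 < b) (hab : b < a)
    (h : a ^ 2 + b ^ 2 = 1 / 2) : √(1 / 2 - 2 * √(toMat (act P (diagPt a b))).det) = a - b := by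
  rw [sqrt_det_act_diagPt P hb hab, ← h,
    show a ^ 2 + b ^ 2 - 2 * (a * b) = (a - b) ^ 2 by ring, Real.sqrt_sq (sub_pos.2 hab).le]

theorem sqrt_add_act_diagPt (P : SO4) {a b : ℝ} (hb : 0 < b) (hab : b < a)
    (h : a ^ 2 + b ^ 2 = 1 / 2) : √(1 / 2 + 2 * √(toMat (act P (diagPt a b))).det) = a + b := by
  rw [sqrt_det_act_diagPt P hb hab, ← h,
    show a ^ 2 + b ^ 2 + 2 * (a * b) = (a + b) ^ 2 by ring, Real.sqrt_sq (by linarith)]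

theorem kappa_act_diagPt (P : SO4) {a b : ℝ} (hb : 0 < b) (hab : b < a)
    (h : a ^ 2 + b ^ 2 = 1 / 2) (i : Fin 5) : kappa i (act P (diagPt a b)) =
      (![1 / (a - b), -(1 / (a - b)), 1 / (a + b), -(1 / (a + b)), 0] : Fin 5 → ℝ) i := by
  have h1 := sqrt_sub_act_diagPt P hb hab h
  have h2 := sqrt_add_act_diagPt P hb hab h
  fin_cases i <;> simp only [kappa, one_div] <;> simp [← h1, ← h2]

/-- From a ≠ b follows (a + b)² < 2(a² + b²) = 1. This isolates the curvature 0 uniformly from the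
others and keeps the five values distinct. -/
theorem one_lt_inv_add {a b : ℝ} (hb : 0 < b) (hab : b < a) (h : a ^ 2 + b ^ 2 = 1 / 2) :
    1 < 1 / (a + b) ∧ 1 / (a + b) < 1 / (a - b) := by
  have h1 : 0 < a + b := by linarith
  refine ⟨?_, one_div_lt_one_div_of_lt (sub_pos.2 hab) (by linarith)⟩
  rw [one_lt_div h1]
  nlinarith [mul_pos (sub_pos.2 hab) (sub_pos.2 hab)]

theorem kappa_injective {A : SymMat} (hA : A ∈ Btilde) :
    Function.Injective fun i => kappa i A := by
  obtain ⟨P, a, b, hb, hab, h, rfl⟩ := mem_Btilde_iff.1 hA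
  obtain ⟨h1, h2⟩ := one_lt_inv_add hb hab h
  intro i j hij
  simp only [kappa_act_diagPt P hb hab h] at hij
  generalize 1 / (a + b) = p at *
  generalize 1 / (a - b) = q at *
  fin_cases i <;> fin_cases j <;> first
    | rfl
    | (exfalso; simp at hij; linarith)

theorem act_frameAt_ne_zero (P : SO4) {a b : ℝ} (hb : 0 < b) (hab : b < a)
    (h : a ^ 2 + b ^ 2 = 1 / 2) (s : Fin 7) : act P (frameAt a b s) ≠ 0 := by
  intro h0
  refine frameAt_ne_zero hb hab h s (norm_eq_zero.1 ?_)
  rw [← norm_act P, h0, norm_zero]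

theorem isPrincipalCurvature_iff {A : SymMat} (hA : A ∈ Btilde) (c : ℝ) :
    IsPrincipalCurvature Btilde unitNormal A c ↔ ∃ i, kappa i A = c := by
  obtain ⟨P, a, b, hb, hab, h, rfl⟩ := mem_Btilde_iff.1 hA
  rw [IsPrincipalCurvature, principalSpace_act_diagPt P hb hab h]
  simp only [kappa_act_diagPt P hb hab h]
  have h1 : Submodule.span ℝ ((fun s => act P (frameAt a b s)) '' {s | curvAt a b s = c}) ≠ ⊥ ↔
      ∃ s, curvAt a b s = c := by
    rw [Ne, Submodule.span_eq_bot, not_forall]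
    constructor
    · rintro ⟨x, hx⟩
      obtain ⟨s, hs, -⟩ := (Classical.not_imp.1 hx).1
      exact ⟨s, hs⟩
    · rintro ⟨s, hs⟩
      exact ⟨_, Classical.not_imp.2 ⟨⟨s, hs, rfl⟩, act_frameAt_ne_zero P hb hab h s⟩⟩
  rw [h1]
  constructor
  · rintro ⟨s, rfl⟩
    exact ⟨(![4, 0, 2, 3, 1, 4, 4] : Fin 7 → Fin 5) s, by fin_cases s <;> rfl⟩
  · rintro ⟨i, rfl⟩
    exact ⟨(![1, 4, 2, 3, 0] : Fin 5 → Fin 7) i, by fin_cases i <;> rfl⟩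

/-- The principal spaces in terms of the frame. -/
theorem principalSpace_kappa (P : SO4) {a b : ℝ} (hb : 0 < b) (hab : b < a)
    (h : a ^ 2 + b ^ 2 = 1 / 2) (i : Fin 5) :
    principalSpace Btilde unitNormal (act P (diagPt a b)) (kappa i (act P (diagPt a b))) =
      Submodule.span ℝ ((fun s => act P (frameAt a b s)) ''
        (![{1}, {4}, {2}, {3}, {0, 5, 6}] : Fin 5 → Set (Fin 7)) i) := by
  rw [principalSpace_act_diagPt P hb hab h, kappa_act_diagPt P hb hab h]
  congr 2
  obtain ⟨h1, h2⟩ := one_lt_inv_add hb hab h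
  ext s
  rw [Set.mem_ofPred_eq, curvAt]
  generalize 1 / (a + b) = p at *
  generalize 1 / (a - b) = q at *
  fin_cases i <;> fin_cases s <;> simp <;> linarith

/-! ### The Dupin property -/

theorem planeIdx_sub_ne_zero {a b : ℝ} (hb : 0 < b) (hab : b < a) {i j : Fin 4} (hij : i ≠ j) :
    (![a, -a, b, -b] i - ![a, -a, b, -b] j : ℝ) ≠ 0 := by
  intro h
  fin_cases i <;> fin_cases j <;> first
    | exact absurd rfl hij
    | (simp at h; linarith)

/-- The determinant is constant along the rotation curve with this velocity, up to the nonzero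
factor √2(μ_i - μ_j). -/
theorem fderiv_det_act_Ehat (P : SO4) {a b : ℝ} (hb : 0 < b) (hab : b < a) {i j : Fin 4}
    (hij : i ≠ j) :
    fderiv ℝ (fun A : SymMat => (toMat A).det) (act P (diagPt a b)) (act P (Ehat i j)) = 0 := by
  have h1 := (actL P).hasFDerivAt.comp_hasDerivAt 0
    (hasDerivAt_act_rot_diagonal hij (toMat_diagPt a b))
  have h2 := (contDiff_det.differentiable (by simp) (act P (diagPt a b))).hasFDerivAt
  have h3 := h2.comp_hasDerivAt_of_eq 0 h1 (by simp [rotSO_zero])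
  have h4 : ((fun A : SymMat => (toMat A).det) ∘ actL P ∘ fun t => act (rotSO hij t) (diagPt a b)) =
      fun _ => a ^ 2 * b ^ 2 := by
    ext1 t
    simp only [Function.comp_apply, actL_apply, det_act, det_diagPt]
  rw [h4] at h3
  have h5 := h3.unique (hasDerivAt_const _ _)
  rw [actL_apply, act_smul, map_smul, smul_eq_mul] at h5
  exact (mul_eq_zero.1 h5).resolve_left
    (mul_ne_zero (by positivity) (planeIdx_sub_ne_zero hb hab hij))

theorem fderiv_det_eq_zero {A v : SymMat} (hA : A ∈ Btilde) {c : ℝ} (hc : c ≠ 0)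
    (hv : v ∈ principalSpace Btilde unitNormal A c) :
    fderiv ℝ (fun A : SymMat => (toMat A).det) A v = 0 := by
  obtain ⟨P, a, b, hb, hab, h, rfl⟩ := mem_Btilde_iff.1 hA
  rw [principalSpace_act_diagPt P hb hab h] at hv
  induction hv using Submodule.span_induction with
  | mem x hx =>
    obtain ⟨s, hs, rfl⟩ := hx
    -- X₁ is the only frame direction that is not rotational, and its curvature is 0.
    have hs6 : s ≠ 6 := by
      rintro rfl
      exact hc hs.symm
    simp only [frameAt_eq_Ehat a b hs6]
    exact fderiv_det_act_Ehat P hb hab (planeIdx_ne s)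
  | zero => simp
  | add x y _ _ hx hy => rw [map_add, hx, hy, add_zero]
  | smul d x _ hx => rw [map_smul, hx, smul_zero]

theorem eq_zero_or_one_lt_sq {A : SymMat} (hA : A ∈ Btilde) {c : ℝ}
    (hc : IsPrincipalCurvature Btilde unitNormal A c) : c = 0 ∨ 1 < c ^ 2 := by
  obtain ⟨i, rfl⟩ := (isPrincipalCurvature_iff hA c).1 hc
  obtain ⟨P, a, b, hb, hab, h, rfl⟩ := mem_Btilde_iff.1 hA
  obtain ⟨h1, h2⟩ := one_lt_inv_add hb hab h
  rw [kappa_act_diagPt P hb hab h]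
  generalize 1 / (a + b) = p at *
  generalize 1 / (a - b) = q at *
  fin_cases i <;> simp <;> exact Or.inr (lt_abs.2 (Or.inl (by linarith)))

theorem kappa_congr {A B : SymMat} (h : (toMat A).det = (toMat B).det) (i : Fin 5) :
    kappa i A = kappa i B := by
  fin_cases i <;> simp [kappa, h]

theorem isDupin_unitNormal : IsDupin Btilde unitNormal := by
  intro k O f κ ⟨hO, hf, hfM⟩ hpre hκ x hx y hy
  have hmem : ∀ z ∈ O, ∀ u, fderiv ℝ f z u ∈ principalSpace Btilde unitNormal (f z) (κ z) := by
    intro z hz u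
    rw [← (hκ z hz).2]
    exact ⟨u, rfl⟩
  -- The principal space is nonzero, so the parameter space has a nonzero vector e; by injectivity
  -- its image vanishes nowhere.
  obtain ⟨e, he⟩ : ∃ e, fderiv ℝ f x e ≠ 0 := by
    by_contra! h0
    refine (hκ x hx).1 ?_
    rw [← (hκ x hx).2, LinearMap.range_eq_bot]
    ext1 u
    exact h0 u
  have he0 : e ≠ 0 := by
    rintro rfl
    exact he (map_zero _)
  have hne : ∀ z ∈ O, ⟪fderiv ℝ f z e, fderiv ℝ f z e⟫ ≠ 0 := fun z hz =>
    inner_self_ne_zero.2 fun h0 => he0 ((hfM z hz).2 (h0.trans (map_zero _).symm))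
  have hfd : ContinuousOn (fun z => fderiv ℝ f z e) O :=
    (hf.continuousOn_fderiv_of_isOpen hO (by simp)).clm_apply continuousOn_const
  have hξd : ContinuousOn (fun z => fderiv ℝ unitNormal (f z)) O :=
    (contDiffOn_unitNormal.continuousOn_fderiv_of_isOpen isOpen_gradF3_ne_zero (by simp)).comp
      hf.continuousOn fun z hz => gradF3_ne_zero (hfM z hz).1
  -- κ is not assumed continuous; it is the Rayleigh quotient of the shape operator on df(e).
  have hcont : ContinuousOn κ O := by
    refine (((hξd.clm_apply hfd).neg.inner hfd).div (hfd.inner hfd) hne).congr fun z hz => ?_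
    obtain ⟨h1, h2⟩ := hmem z hz e
    rw [fderivWithin_eq_of_extension isOpen_univ (Set.mem_univ _) (hfM z hz).1
      (differentiableAt_unitNormal (hfM z hz).1) (fun _ _ => rfl) h1] at h2
    change κ z = ⟪-(fderiv ℝ unitNormal (f z) (fderiv ℝ f z e)), fderiv ℝ f z e⟫ / _
    rw [h2, inner_smul_symMat, mul_div_cancel_right₀ _ (hne z hz)]
  by_cases h0 : ∃ z ∈ O, κ z = 0
  · obtain ⟨z, hz, hz0⟩ := h0
    have key : ∀ w ∈ O, κ w = 0 := by
      intro w hw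
      by_contra hw0
      have h1 := (eq_zero_or_one_lt_sq (hfM w hw).1 (hκ w hw).1).resolve_left hw0
      -- If κ vanished somewhere but not everywhere, κ² would take the value 1/2, which lies in the
      -- gap between 0 and 1.
      obtain ⟨p, hp, hp2⟩ := hpre.intermediate_value hz hw (hcont.pow 2)
        (show (1 / 2 : ℝ) ∈ Set.Icc _ _ from ⟨by simp [hz0], by simp; linarith⟩)
      have hp2' : κ p ^ 2 = 1 / 2 := hp2
      rcases eq_zero_or_one_lt_sq (hfM p hp).1 (hκ p hp).1 with h2 | h2
      · rw [h2] at hp2'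
        norm_num at hp2'
      · linarith
    rw [key x hx, key y hy]
  · push Not at h0
    have hdet : ∀ z ∈ O, (toMat (f z)).det = (toMat (f x)).det := by
      intro z hz
      have hd : ∀ w ∈ O, HasFDerivAt (fun w => (toMat (f w)).det)
          ((fderiv ℝ (fun A : SymMat => (toMat A).det) (f w)).comp (fderiv ℝ f w)) w := fun w hw =>
        (contDiff_det.differentiable (by simp) (f w)).hasFDerivAt.comp w
          (((hf w hw).contDiffAt (hO.mem_nhds hw)).differentiableAt (by simp)).hasFDerivAt
      refine hO.is_const_of_fderiv_eq_zero (𝕜 := ℝ) hpre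
        (fun w hw => (hd w hw).differentiableAt.differentiableWithinAt) (fun w hw => ?_) hz hx
      rw [(hd w hw).fderiv]
      ext1 u
      exact fderiv_det_eq_zero (hfM w hw).1 (h0 w hw) (hmem w hw u)
    have hfin : κ '' O ⊆ Set.range fun i => kappa i (f x) := by
      rintro _ ⟨z, hz, rfl⟩
      obtain ⟨i, hi⟩ := (isPrincipalCurvature_iff (hfM z hz).1 _).1 (hκ z hz).1
      exact ⟨i, by rw [← hi]; exact (kappa_congr (hdet z hz) i).symm⟩
    -- As det is constant on the surface, κ takes values in one finite set, and the continuous image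
    -- of a preconnected set in it is a single point.
    exact (Set.finite_range _).countable.isTotallyDisconnected _ hfin (hpre.image κ hcont)
      (Set.mem_image_of_mem κ hx) (Set.mem_image_of_mem κ hy)

theorem isProperDupin_Btilde : IsProperDupin Btilde := by
  refine ⟨isSphereHypersurface_Btilde, unitNormal, isUnitNormal_unitNormal, isDupin_unitNormal, 5,
    fun A hA => ?_⟩
  have : {κ : ℝ | IsPrincipalCurvature Btilde unitNormal A κ} = Set.range fun i => kappa i A := by
    ext c
    exact isPrincipalCurvature_iff hA c
  rw [this, ← Set.image_univ, (kappa_injective hA).encard_image, Set.encard_univ]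
  simp

/-! ### Arbitrary unit normal fields -/

/-- Orthogonality to D and to the whole frame leaves only multiples of J in the traceless symmetric
matrices; since |J| = 2 the factor is ±1/2. -/
theorem eq_or_eq_neg_unitNormal {ξ : SymMat → SymMat} (hξ : IsUnitNormal Btilde ξ) {A : SymMat}
    (hA : A ∈ Btilde) : ξ A = unitNormal A ∨ ξ A = -unitNormal A := by
  obtain ⟨h1, h2, h3⟩ := hξ.2 A hA
  obtain ⟨P, a, b, hb, hab, h, rfl⟩ := mem_Btilde_iff.1 hA
  rw [unitNormal_act, unitNormal_diagPt hb hab h]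
  rw [← act_act_inv P (ξ _)] at h1 h2 h3 ⊢
  generalize act P⁻¹ (ξ (act P (diagPt a b))) = w at *
  rw [norm_act] at h1
  rw [inner_act_act, real_inner_comm] at h2
  have hs2 : √2 ≠ (0 : ℝ) := by positivity
  have hE : ∀ s, ⟪w, frameAt a b s⟫ = 0 := fun s => by
    rw [← inner_act_act P, real_inner_comm]
    exact h3 _ (act_frameAt_mem_tangentSpace P hb hab h s)
  have hoff : ∀ s, s ≠ 6 → toMat w (planeIdx s).1 (planeIdx s).2 = 0 := fun s hs => by
    have := hE s
    rw [frameAt_eq_Ehat a b hs, inner_Ehat _ (planeIdx_ne s)] at this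
    exact (mul_eq_zero.1 this).resolve_left hs2
  have h6 : ⟪w, diagPt b (-a)⟫ = 0 := by
    have := hE 6
    change ⟪w, X1 (diagPt a b)⟫ = 0 at this
    rw [X1_diagPt h, real_inner_comm, inner_smul_symMat, real_inner_comm] at this
    exact (mul_eq_zero.1 this).resolve_left (X1_coeff_pos hb hab).ne'
  rw [inner_diagonal _ (toMat_diagPt _ _), Fin.sum_univ_four] at h2 h6
  have h7 := trace_toMat w
  simp only [Matrix.trace, Matrix.diag, Fin.sum_univ_four] at h7
  simp at h2 h6
  -- `h2` and `h6` are a linear system in w₀₀ - w₁₁ and w₂₂ - w₃₃ with determinant -(a² + b²) =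
  -- -1/2.
  have e1 : toMat w 1 1 = toMat w 0 0 := by linear_combination (-2 * a) * h2 - 2 * b * h6 -
    2 * (toMat w 1 1 - toMat w 0 0) * h
  have e2 : toMat w 3 3 = toMat w 2 2 := by linear_combination (-2 * b) * h2 + 2 * a * h6 -
    2 * (toMat w 3 3 - toMat w 2 2) * h
  have e3 : toMat w 2 2 = -toMat w 0 0 := by linarith
  have hw : w = toMat w 0 0 • diagJ := by
    have key : ∀ i j, i ≤ j → toMat w i j = toMat w 0 0 * toMat diagJ i j := by
      intro i j hij
      rw [toMat_diagJ]
      have k0 := hoff 0 (by decide)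
      have k1 := hoff 1 (by decide)
      have k2 := hoff 2 (by decide)
      have k3 := hoff 3 (by decide)
      have k4 := hoff 4 (by decide)
      have k5 := hoff 5 (by decide)
      simp only [planeIdx] at k0 k1 k2 k3 k4 k5
      simp at k0 k1 k2 k3 k4 k5
      fin_cases i <;> fin_cases j <;> first
        | exact absurd hij (by decide)
        | (simp; done)
        | (simp; linarith)
    apply toMat_injective
    ext i j
    rcases le_total i j with hij | hij
    · exact key i j hij
    · rw [toMat_symm w, toMat_symm _ i j]
      exact key j i hij
  rw [hw, norm_smul, norm_diagJ, Real.norm_eq_abs] at h1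
  rcases abs_eq (by norm_num : (0 : ℝ) ≤ 1 / 2) |>.1
    (show |toMat w 0 0| = 1 / 2 by linarith) with h8 | h8
  · right
    rw [hw, h8, ← act_neg, neg_smul, neg_neg]
  · left
    rw [hw, h8]

/-- Multiplying the normal by ε = ±1 multiplies the shape operator by ε; agreement near A inside the
hypersurface suffices, as only tangential derivatives enter. -/
theorem principalSpace_of_eventuallyEq {ξ : SymMat → SymMat} {ε : ℝ} (hε : ε * ε = 1) {A : SymMat}
    (hA : A ∈ Btilde) (h : ∀ᶠ B in 𝓝[Btilde] A, ξ B = ε • unitNormal B) (c : ℝ) :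
    principalSpace Btilde ξ A c = principalSpace Btilde unitNormal A (ε * c) := by
  obtain ⟨U, hU, hAU, hUM⟩ := mem_nhdsWithin.1 h
  have key : ∀ v ∈ tangentSpace Btilde A, fderivWithin ℝ ξ Btilde A v =
      ε • fderivWithin ℝ unitNormal Btilde A v := by
    intro v hv
    have hd := differentiableAt_unitNormal hA
    rw [fderivWithin_eq_of_extension hU hAU hA (hd.const_smul ε) (fun x hx => hUM ⟨hx.2, hx.1⟩) hv,
      fderivWithin_eq_of_extension isOpen_univ (Set.mem_univ _) hA hd (fun _ _ => rfl) hv,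
      fderiv_const_smul hd]
    rfl
  ext v
  refine and_congr_right fun hv => ?_
  change -(fderivWithin ℝ ξ Btilde A v) = c • v ↔
    -(fderivWithin ℝ unitNormal Btilde A v) = (ε * c) • v
  rw [key v hv, mul_smul, ← smul_neg]
  constructor
  · intro h1
    rw [← h1, smul_smul, hε, one_smul]
  · intro h1
    rw [h1, smul_smul, hε, one_smul]

/-- Near a given point, the principal distribution of a continuous principal curvature function
with respect to any unit normal field is one of the five principal distributions. -/
theorem exists_kappa_of_principalCurvature {ξ : SymMat → SymMat} (hξ : IsUnitNormal Btilde ξ)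
    {lam : SymMat → ℝ} (hlam : ContinuousOn lam Btilde)
    (hpc : ∀ p ∈ Btilde, IsPrincipalCurvature Btilde ξ p (lam p)) {A : SymMat} (hA : A ∈ Btilde) :
    ∃ i, ∀ᶠ B in 𝓝[Btilde] A, principalSpace Btilde ξ B (lam B) =
      principalSpace Btilde unitNormal B (kappa i B) := by
  -- The inner product of the two normals is continuous with values ±1, so its sign is locally
  -- constant.
  obtain ⟨ε, hε, hεξ⟩ : ∃ ε : ℝ, ε * ε = 1 ∧ ∀ᶠ B in 𝓝[Btilde] A, ξ B = ε • unitNormal B := by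
    have c1 : ContinuousWithinAt (fun B => ⟪ξ B, unitNormal B⟫) Btilde A :=
      ((hξ.1.differentiableWithinAt hA).continuousWithinAt).inner
        (isSmoothOn_unitNormal.differentiableWithinAt hA).continuousWithinAt
    have hself : ∀ B ∈ Btilde, ⟪unitNormal B, unitNormal B⟫ = 1 := fun B hB => by
      rw [real_inner_self_eq_norm_sq, norm_unitNormal hB, one_pow]
    rcases eq_or_eq_neg_unitNormal hξ hA with h | h
    · refine ⟨1, by norm_num, ?_⟩
      have hpos : 0 < ⟪ξ A, unitNormal A⟫ := by rw [h, hself A hA]; exact one_pos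
      filter_upwards [c1.tendsto.eventually_const_lt hpos, self_mem_nhdsWithin] with B hB hBM
      rcases eq_or_eq_neg_unitNormal hξ hBM with h' | h'
      · rw [h', one_smul]
      · rw [h', inner_neg_left, hself B hBM] at hB
        norm_num at hB
    · refine ⟨-1, by norm_num, ?_⟩
      have hneg : ⟪ξ A, unitNormal A⟫ < 0 := by rw [h, inner_neg_left, hself A hA]; norm_num
      filter_upwards [c1.tendsto.eventually_lt_const hneg, self_mem_nhdsWithin] with B hB hBM
      rcases eq_or_eq_neg_unitNormal hξ hBM with h' | h'
      · rw [h', hself B hBM] at hB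
        norm_num at hB
      · rw [h', neg_smul, one_smul]
  have hps : ∀ᶠ B in 𝓝[Btilde] A, ∀ c, principalSpace Btilde ξ B c =
      principalSpace Btilde unitNormal B (ε * c) := by
    filter_upwards [eventually_eventually_nhdsWithin.2 hεξ, self_mem_nhdsWithin] with B hB hBM
    exact principalSpace_of_eventuallyEq hε hBM hB
  have hex : ∀ᶠ B in 𝓝[Btilde] A, ∃ i, kappa i B = ε * lam B := by
    filter_upwards [hps, self_mem_nhdsWithin] with B hB hBM
    rw [← isPrincipalCurvature_iff hBM, IsPrincipalCurvature, ← hB]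
    exact hpc B hBM
  obtain ⟨i, hi⟩ := hex.self_of_nhdsWithin hA
  -- The other four curvatures differ from ε λ at A, hence nearby by continuity; since some
  -- curvature always equals ε λ, it must be the i-th.
  have hne : ∀ j, j ≠ i → ∀ᶠ B in 𝓝[Btilde] A, kappa j B ≠ ε * lam B := by
    intro j hj
    have c1 : ContinuousWithinAt (kappa j) Btilde A :=
      ((isSmoothOn_kappa j).differentiableWithinAt hA).continuousWithinAt
    have c2 : ContinuousWithinAt (fun B => ε * lam B) Btilde A :=
      continuousWithinAt_const.mul (hlam A hA)
    have hA0 : kappa j A - ε * lam A ≠ 0 := by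
      rw [← hi, sub_ne_zero]
      exact fun h => hj (kappa_injective hA h)
    exact ((c1.sub c2).tendsto.eventually_ne hA0).mono fun B hB => sub_ne_zero.1 hB
  refine ⟨i, ?_⟩
  have hne' : ∀ᶠ B in 𝓝[Btilde] A, ∀ j, j ≠ i → kappa j B ≠ ε * lam B :=
    Filter.eventually_all.2 fun j => Filter.eventually_imp_distrib_left.2 (hne j)
  filter_upwards [hps, hex, hne'] with B h1 h2 h3
  obtain ⟨j, hj⟩ := h2
  have : j = i := by
    by_contra hji
    exact h3 j hji hj
  rw [h1, ← hj, this]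

/-! ### A local diagonalizer -/

/-- The largest eigenvalue, as a function of the determinant. -/
def eigA (B : SymMat) : ℝ :=
  (√(1 / 2 + 2 * √(toMat B).det) + √(1 / 2 - 2 * √(toMat B).det)) / 2

/-- The second eigenvalue, as a function of the determinant. -/
def eigB (B : SymMat) : ℝ :=
  (√(1 / 2 + 2 * √(toMat B).det) - √(1 / 2 - 2 * √(toMat B).det)) / 2

/-- The eigenvalues. -/
def eig : Fin 4 → SymMat → ℝ := ![eigA, fun B => -eigA B, eigB, fun B => -eigB B]

/-- The spectral projections, by Lagrange interpolation. -/
def specProj (i : Fin 4) (B : SymMat) : Matrix (Fin 4) (Fin 4) ℝ :=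
  (2 * eig i B * (2 * eig i B ^ 2 - 1 / 2))⁻¹ •
    ((toMat B ^ 2 - (1 / 2 - eig i B ^ 2) • 1) * (toMat B + eig i B • 1))

theorem eigA_act_diagPt (P : SO4) {a b : ℝ} (hb : 0 < b) (hab : b < a)
    (h : a ^ 2 + b ^ 2 = 1 / 2) : eigA (act P (diagPt a b)) = a := by
  rw [eigA, sqrt_sub_act_diagPt P hb hab h, sqrt_add_act_diagPt P hb hab h]
  ring

theorem eigB_act_diagPt (P : SO4) {a b : ℝ} (hb : 0 < b) (hab : b < a)
    (h : a ^ 2 + b ^ 2 = 1 / 2) : eigB (act P (diagPt a b)) = b := by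
  rw [eigB, sqrt_sub_act_diagPt P hb hab h, sqrt_add_act_diagPt P hb hab h]
  ring

theorem eigB_pos {B : SymMat} (hB : B ∈ detRange) : 0 < eigB B := by
  have h1 : 0 < √(toMat B).det := Real.sqrt_pos.2 hB.1
  have h2 : √(1 / 2 - 2 * √(toMat B).det) < √(1 / 2 + 2 * √(toMat B).det) :=
    Real.sqrt_lt_sqrt (sqrt_det_lt hB).le (by linarith)
  rw [eigB]
  linarith

theorem eigB_lt_eigA {B : SymMat} (hB : B ∈ detRange) : eigB B < eigA B := by
  have h1 := Real.sqrt_pos.2 (sqrt_det_lt hB)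
  rw [eigA, eigB]
  linarith

theorem eigA_sq_add_eigB_sq {B : SymMat} (hB : B ∈ detRange) :
    eigA B ^ 2 + eigB B ^ 2 = 1 / 2 := by
  have h1 := Real.sq_sqrt (sqrt_det_lt hB).le
  have h2 := Real.sq_sqrt (show 0 ≤ 1 / 2 + 2 * √(toMat B).det by positivity)
  rw [eigA, eigB]
  linear_combination (h1 + h2) / 2

theorem eig_act_diagPt (P : SO4) {a b : ℝ} (hb : 0 < b) (hab : b < a)
    (h : a ^ 2 + b ^ 2 = 1 / 2) (i : Fin 4) :
    eig i (act P (diagPt a b)) = (![a, -a, b, -b] : Fin 4 → ℝ) i := by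
  have hA := eigA_act_diagPt P hb hab h
  have hB := eigB_act_diagPt P hb hab h
  fin_cases i
  exacts [hA, congrArg Neg.neg hA, hB, congrArg Neg.neg hB]

theorem contDiffOn_eig (i : Fin 4) : ContDiffOn ℝ ∞ (eig i) detRange := by
  have hA : ContDiffOn ℝ ∞ eigA detRange :=
    (contDiffOn_sqrt_add.add contDiffOn_sqrt_sub).div_const 2
  have hB : ContDiffOn ℝ ∞ eigB detRange :=
    (contDiffOn_sqrt_add.sub contDiffOn_sqrt_sub).div_const 2
  fin_cases i
  exacts [hA, hA.neg, hB, hB.neg]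

/-- This is the Lagrange denominator: the value at x = μ_i of (x² - c²)(x + μ_i), where c² = 1/2 -
μ_i² is the square of the other pair of eigenvalues. -/
theorem eig_coeff_ne_zero {B : SymMat} (hB : B ∈ detRange) (i : Fin 4) :
    2 * eig i B * (2 * eig i B ^ 2 - 1 / 2) ≠ 0 := by
  have h1 := eigB_pos hB
  have h2 := eigB_lt_eigA hB
  have h3 := eigA_sq_add_eigB_sq hB
  have h4 : eigB B ^ 2 < eigA B ^ 2 := by nlinarith
  have key : ∀ c : ℝ, c ≠ 0 → 2 * c ^ 2 - 1 / 2 ≠ 0 → 2 * c * (2 * c ^ 2 - 1 / 2) ≠ 0 :=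
    fun c hc hc' => mul_ne_zero (mul_ne_zero two_ne_zero hc) hc'
  have hA : 2 * eigA B ^ 2 - 1 / 2 ≠ 0 := by
    intro h
    linarith
  have hB : 2 * eigB B ^ 2 - 1 / 2 ≠ 0 := by
    intro h
    linarith
  have hA0 : eigA B ≠ 0 := (h1.trans h2).ne'
  fin_cases i
  exacts [key _ hA0 hA, key (-eigA B) (neg_ne_zero.2 hA0) (by rwa [neg_sq]), key _ h1.ne' hB,
    key (-eigB B) (neg_ne_zero.2 h1.ne') (by rwa [neg_sq])]

theorem matSmoothOn_specProj (i : Fin 4) : MatSmoothOn (specProj i) detRange := by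
  have hX : MatSmoothOn toMat detRange := matSmoothOn_toMat contDiffOn_id
  have he := contDiffOn_eig i
  exact MatSmoothOn.smul (((contDiffOn_const.mul he).mul
    ((contDiffOn_const.mul (he.pow 2)).sub contDiffOn_const)).inv fun x hx => eig_coeff_ne_zero hx i)
    (((hX.pow 2).sub (MatSmoothOn.smul (contDiffOn_const.sub (he.pow 2)) (MatSmoothOn.const 1))).mul
      (hX.add (MatSmoothOn.smul he (MatSmoothOn.const 1))))

theorem specProj_act (P : SO4) {a b : ℝ} (hb : 0 < b) (hab : b < a)
    (h : a ^ 2 + b ^ 2 = 1 / 2) (i : Fin 4) :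
    specProj i (act P (diagPt a b)) = P.1ᵀ * specProj i (diagPt a b) * P.1 := by
  have h0 := P.mul_transpose
  have he : eig i (act P (diagPt a b)) = eig i (diagPt a b) := by
    rw [eig_act_diagPt P hb hab h, ← act_one (diagPt a b), eig_act_diagPt 1 hb hab h]
  have hmul : ∀ X Y : Matrix (Fin 4) (Fin 4) ℝ,
      P.1ᵀ * X * P.1 * (P.1ᵀ * Y * P.1) = P.1ᵀ * (X * Y) * P.1 := fun X Y => by
    calc _ = P.1ᵀ * X * (P.1 * P.1ᵀ) * Y * P.1 := by simp only [Matrix.mul_assoc]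
      _ = _ := by rw [h0]; simp only [Matrix.mul_assoc, Matrix.one_mul]
  rw [specProj, specProj, he, toMat_act, conj_pow h0, Matrix.mul_smul, Matrix.smul_mul, ← hmul]
  simp only [Matrix.mul_add, Matrix.add_mul, Matrix.mul_sub, Matrix.sub_mul, Matrix.mul_smul,
    Matrix.smul_mul, Matrix.mul_one, P.transpose_mul]

theorem specProj_diagPt {a b : ℝ} (hb : 0 < b) (hab : b < a)
    (h : a ^ 2 + b ^ 2 = 1 / 2) (i : Fin 4) : specProj i (diagPt a b) = Matrix.single i i 1 := by
  have he := eig_act_diagPt 1 hb hab h i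
  rw [act_one] at he
  have hc := eig_coeff_ne_zero (Btilde_subset_detRange
    (mem_Btilde_iff.2 ⟨1, a, b, hb, hab, h, (act_one _).symm⟩)) i
  rw [specProj, he]
  rw [he] at hc
  have h1 : ∀ c : ℝ, c • (1 : Matrix (Fin 4) (Fin 4) ℝ) = Matrix.diagonal fun _ => c := fun c => by
    rw [Matrix.smul_one_eq_diagonal]
  rw [toMat_diagPt, Matrix.diagonal_pow, h1, h1, Matrix.diagonal_sub, Matrix.diagonal_add,
    Matrix.diagonal_mul_diagonal, ← Matrix.diagonal_single, ← Matrix.diagonal_smul]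
  congr 1
  ext k
  have hb2 : b ^ 2 = 1 / 2 - a ^ 2 := by linarith
  rw [Pi.smul_apply, smul_eq_mul, inv_mul_eq_iff_eq_mul₀ hc, Pi.pow_apply]
  fin_cases i <;> fin_cases k <;> simp [hb2] <;> ring

/-- The i-th row of P is a unit eigenvector, and the projection is its outer square. Dividing the
i-th row of the projection by the root of its (i, i) entry therefore recovers that row up to sign.
-/
theorem specProj_act_apply (P : SO4) {a b : ℝ} (hb : 0 < b) (hab : b < a)
    (h : a ^ 2 + b ^ 2 = 1 / 2) (i j k : Fin 4) :
    specProj i (act P (diagPt a b)) j k = P.1 i j * P.1 i k := by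
  rw [specProj_act P hb hab h, specProj_diagPt hb hab h, Matrix.mul_apply]
  simp only [Matrix.mul_apply, Matrix.transpose_apply, Matrix.single_apply]
  rw [Finset.sum_eq_single i, Finset.sum_eq_single i]
  · simp
  · intro l _ hl
    simp [hl.symm]
  · simp
  · intro l _ hl
    simp [hl.symm]
  · simp

/-- The matrix whose rows are unit eigenvectors, with positive diagonal entries. -/
def frameMat (B : SymMat) : Matrix (Fin 4) (Fin 4) ℝ :=
  Matrix.of fun i j => specProj i B i j / √(specProj i B i i)

/-- The open set on which the rows of `frameMat` are defined. -/
def frameDomain : Set SymMat := {B | B ∈ detRange ∧ ∀ i, 0 < specProj i B i i}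

/-- The domain of the local diagonalizer. -/
def diagDomain : Set SymMat := {B | B ∈ frameDomain ∧ 0 < (frameMat B).det}

theorem isOpen_frameDomain : IsOpen frameDomain := by
  have : frameDomain = ⋂ i, (detRange ∩ (fun B => specProj i B i i) ⁻¹' Set.Ioi 0) := by
    ext B
    simp [frameDomain, forall_and]
  rw [this]
  exact isOpen_iInter_of_finite fun i =>
    (matSmoothOn_specProj i i i).continuousOn.isOpen_inter_preimage isOpen_detRange isOpen_Ioi

theorem matSmoothOn_frameMat : MatSmoothOn frameMat frameDomain := fun i j =>
  ((matSmoothOn_specProj i i j).mono fun _ hB => hB.1).div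
    (((matSmoothOn_specProj i i i).mono fun _ hB => hB.1).sqrt fun _ hB => (hB.2 i).ne')
    fun _ hB => (Real.sqrt_pos.2 (hB.2 i)).ne'

theorem isOpen_diagDomain : IsOpen diagDomain :=
  matSmoothOn_frameMat.det.continuousOn.isOpen_inter_preimage isOpen_frameDomain isOpen_Ioi

theorem frameMat_act_apply (P : SO4) {a b : ℝ} (hb : 0 < b) (hab : b < a)
    (h : a ^ 2 + b ^ 2 = 1 / 2) (i j : Fin 4) :
    frameMat (act P (diagPt a b)) i j = P.1 i i / |P.1 i i| * P.1 i j := by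
  rw [frameMat, Matrix.of_apply, specProj_act_apply P hb hab h, specProj_act_apply P hb hab h,
    Real.sqrt_mul_self_eq_abs]
  ring

open Classical in
/-- The local diagonalizer. -/
def localDiag (B : SymMat) : SO4 :=
  if h : frameMat B ∈ Matrix.specialOrthogonalGroup (Fin 4) ℝ then ⟨frameMat B, h⟩ else 1

/-- Positive diagonal entries remove the sign ambiguity of the rows, so the diagonalizer is known
explicitly along small rotations of D. -/
theorem localDiag_act {P : SO4} {a b : ℝ} (hb : 0 < b) (hab : b < a)
    (h : a ^ 2 + b ^ 2 = 1 / 2) (hP : ∀ i, 0 < P.1 i i) :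
    localDiag (act P (diagPt a b)) = P := by
  have h1 : frameMat (act P (diagPt a b)) = P.1 := by
    ext i j
    rw [frameMat_act_apply P hb hab h, abs_of_pos (hP i), div_self (hP i).ne', one_mul]
  have h2 : frameMat (act P (diagPt a b)) ∈ Matrix.specialOrthogonalGroup (Fin 4) ℝ := by
    rw [h1]
    exact P.2
  rw [localDiag, dif_pos h2]
  exact Subtype.ext h1

theorem diagPt_mem_diagDomain {a b : ℝ} (hb : 0 < b) (hab : b < a) (h : a ^ 2 + b ^ 2 = 1 / 2) :
    diagPt a b ∈ diagDomain := by
  have hm : diagPt a b ∈ Btilde := mem_Btilde_iff.2 ⟨1, a, b, hb, hab, h, (act_one _).symm⟩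
  have h1 : frameMat (diagPt a b) = 1 := by
    ext i j
    rw [← act_one (diagPt a b), frameMat_act_apply 1 hb hab h]
    simp
  refine ⟨⟨Btilde_subset_detRange hm, fun i => ?_⟩, ?_⟩
  · rw [specProj_diagPt hb hab h]
    simp
  · rw [h1, Matrix.det_one]
    exact one_pos

theorem localDiag_spec {B : SymMat} (hB : B ∈ Btilde ∩ diagDomain) :
    (localDiag B).1 = frameMat B ∧ ∃ a b : ℝ, 0 < b ∧ b < a ∧ a ^ 2 + b ^ 2 = 1 / 2 ∧
      B = act (localDiag B) (diagPt a b) := by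
  obtain ⟨hBM, ⟨-, hpos⟩, hdet⟩ := hB
  obtain ⟨P, a, b, hb, hab, h, rfl⟩ := mem_Btilde_iff.1 hBM
  have hne : ∀ i, P.1 i i ≠ 0 := fun i h0 => by
    have := hpos i
    rw [specProj_act_apply P hb hab h, h0] at this
    simp at this
  set s : Fin 4 → ℝ := fun i => P.1 i i / |P.1 i i| with hs
  have hss : ∀ i, s i * s i = 1 := fun i => by
    rw [hs, div_mul_div_comm, abs_mul_abs_self, div_self (mul_self_ne_zero.2 (hne i))]
  -- The sign matrix diag(s) is an orthogonal involution commuting with diagonal matrices, so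
  -- changing P by it keeps both orthogonality and the diagonalization; the positive determinant on
  -- `diagDomain` then puts the product in SO(4).
  have hF : frameMat (act P (diagPt a b)) = Matrix.diagonal s * P.1 := by
    ext i j
    rw [frameMat_act_apply P hb hab h, Matrix.diagonal_mul]
  have hSS : ∀ ν : Fin 4 → ℝ, Matrix.diagonal s * Matrix.diagonal ν * Matrix.diagonal s =
      Matrix.diagonal ν := fun ν => by
    rw [Matrix.diagonal_mul_diagonal, Matrix.diagonal_mul_diagonal]
    congr 1
    ext i
    linear_combination ν i * hss i
  have horth : frameMat (act P (diagPt a b)) * (frameMat (act P (diagPt a b)))ᵀ = 1 := by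
    rw [hF, Matrix.transpose_mul, Matrix.diagonal_transpose]
    calc _ = Matrix.diagonal s * (P.1 * P.1ᵀ) * Matrix.diagonal s := by
          simp only [Matrix.mul_assoc]
      _ = 1 := by rw [P.mul_transpose, ← Matrix.diagonal_one, hSS]
  have hdet1 : (frameMat (act P (diagPt a b))).det = 1 := by
    have h2 : (frameMat (act P (diagPt a b))).det * (frameMat (act P (diagPt a b))).det = 1 := by
      simpa using congrArg Matrix.det horth
    rcases mul_self_eq_one_iff.1 h2 with h3 | h3
    · exact h3
    · rw [h3] at hdet
      norm_num at hdet
  have hval : (localDiag (act P (diagPt a b))).1 = frameMat (act P (diagPt a b)) := by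
    rw [localDiag, dif_pos (mem_SO4 horth hdet1)]
  refine ⟨hval, a, b, hb, hab, h, toMat_injective ?_⟩
  rw [toMat_act (localDiag (act P (diagPt a b))), hval, hF, toMat_act, toMat_diagPt,
    Matrix.transpose_mul, Matrix.diagonal_transpose]
  calc P.1ᵀ * Matrix.diagonal ![a, -a, b, -b] * P.1 =
      P.1ᵀ * (Matrix.diagonal s * Matrix.diagonal ![a, -a, b, -b] * Matrix.diagonal s) * P.1 := by
        rw [hSS]
    _ = _ := by simp only [Matrix.mul_assoc]

theorem isLocalDiagonalizer_localDiag {a b : ℝ} (hb : 0 < b) (hab : b < a)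
    (h : a ^ 2 + b ^ 2 = 1 / 2) : IsLocalDiagonalizer (diagPt a b) diagDomain localDiag := by
  refine ⟨isOpen_diagDomain, diagPt_mem_diagDomain hb hab h, ?_, fun i j => ?_, fun B hB => ?_⟩
  · conv_lhs => rw [← act_one (diagPt a b)]
    exact localDiag_act hb hab h fun i => by simp
  · refine IsSmoothOn.of_contDiffOn isOpen_diagDomain
      ((matSmoothOn_frameMat i j).mono fun _ hB => hB.1) (fun _ hB => hB.2) fun B hB => ?_
    rw [(localDiag_spec hB).1]
  · obtain ⟨-, a', b', hb', hab', h', hB'⟩ := localDiag_spec hB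
    exact ⟨_, ⟨a', b', hb', hab', rfl, (norm_diagPt_eq_one_iff _ _).2 h'⟩, hB'⟩

/-! ### The frame fields and their derivatives -/

/-- Off the hypersurface `frameMat` need not be orthogonal and the conjugate need not be traceless;
projecting it yields an ambient smooth extension of the frame field. -/
theorem contDiffOn_symPart_frameMat (V : SymMat) : ContDiffOn ℝ ∞
    (fun B => symPart ((frameMat B)ᵀ * toMat V * frameMat B)) diagDomain :=
  ((matSmoothOn_frameMat.transpose.mul (MatSmoothOn.const _)).mul matSmoothOn_frameMat).symPart.mono
    fun _ hB => hB.1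

theorem Yfield_eq_symPart {B : SymMat} (hB : B ∈ Btilde ∩ diagDomain) (i j : Fin 4) :
    Yfield localDiag i j B = symPart ((frameMat B)ᵀ * toMat (Ehat i j) * frameMat B) := by
  rw [← (localDiag_spec hB).1, ← toMat_act, symPart_toMat]
  rfl

theorem isSmoothOn_Yfield (i j : Fin 4) :
    IsSmoothOn (Yfield localDiag i j) (Btilde ∩ diagDomain) :=
  IsSmoothOn.of_contDiffOn isOpen_diagDomain (contDiffOn_symPart_frameMat (Ehat i j))
    (fun _ hB => hB.2) fun _ hB => Yfield_eq_symPart hB i j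

theorem isSmoothOn_frame (s : Fin 7) :
    IsSmoothOn (frame localDiag s) (Btilde ∩ diagDomain) := by
  have hX : IsSmoothOn X1 (Btilde ∩ diagDomain) := by
    have h : MatSmoothOn toMat Set.univ := matSmoothOn_toMat contDiffOn_id
    refine IsSmoothOn.of_contDiffOn isOpen_univ (contDiffOn_of_toMat ?_) (Set.subset_univ _)
      fun _ _ => rfl
    simp only [toMat_X1]
    exact ((h.pow 3).sub (MatSmoothOn.smul ((h.pow 3).trace.div_const 4)
      (MatSmoothOn.const 1))).sub (MatSmoothOn.smul (h.pow 4).trace h)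
  fin_cases s
  exacts [isSmoothOn_Yfield 0 1, isSmoothOn_Yfield 0 2, isSmoothOn_Yfield 0 3,
    isSmoothOn_Yfield 1 2, isSmoothOn_Yfield 1 3, isSmoothOn_Yfield 2 3, hX]

theorem frame_act_diagPt {P : SymMat → SO4} {B : SymMat} {a b : ℝ}
    (hB : B = act (P B) (diagPt a b)) (s : Fin 7) :
    frame P s B = act (P B) (frameAt a b s) := by
  have hX : X1 B = act (P B) (X1 (diagPt a b)) := by
    conv_lhs => rw [hB, X1_act]
  fin_cases s
  exacts [rfl, rfl, rfl, rfl, rfl, rfl, hX]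

theorem Ehat_comm (i j : Fin 4) : Ehat i j = Ehat j i := by
  by_cases h : i = j
  · rw [h]
  · apply toMat_injective
    rw [toMat_Ehat h, toMat_Ehat (Ne.symm h), add_comm]

theorem Yfield_comm (P : SymMat → SO4) (i j : Fin 4) : Yfield P i j = Yfield P j i := by
  ext1 B
  rw [Yfield, Ehat_comm, Yfield]

theorem toMat_Ehat_commutator {p q r : Fin 4} (hpq : p ≠ q) (hqr : q ≠ r) (hpr : p ≠ r) :
    toMat (Ehat p r) = toMat (Ehat p q) * rotGen q r - rotGen q r * toMat (Ehat p q) := by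
  rw [toMat_Ehat hpr, toMat_Ehat hpq, rotGen]
  simp only [Matrix.smul_mul, Matrix.mul_smul, add_mul, mul_add, sub_mul, mul_sub,
    Matrix.single_mul_single_same, Matrix.single_mul_single_of_ne, ne_eq, hpq, hqr, hpr, hpq.symm,
    hqr.symm, hpr.symm, not_false_eq_true, mul_one]
  module

theorem rot_apply_self_pos {i j : Fin 4} (h : i ≠ j) {t : ℝ} (ht : 0 < Real.cos t) (k : Fin 4) :
    0 < rot i j t k k := by
  simp only [rot, rotGen, Matrix.add_apply, Matrix.sub_apply, Matrix.smul_apply, smul_eq_mul,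
    Matrix.one_apply_eq, Matrix.single_apply]
  by_cases h1 : i = k
  · subst h1
    simp [h.symm, ht]
  · by_cases h2 : j = k
    · subst h2
      simp [h, ht]
    · simp [h1, h2]

theorem differentiableWithinAt_Yfield {B : SymMat} (hB : B ∈ Btilde ∩ diagDomain) (i j : Fin 4) :
    DifferentiableWithinAt ℝ (Yfield localDiag i j) Btilde B :=
  (differentiableWithinAt_inter (isOpen_diagDomain.mem_nhds hB.2)).1
    ((isSmoothOn_Yfield i j).differentiableWithinAt hB)

theorem diagPt_mem {a b : ℝ} (hb : 0 < b) (hab : b < a) (h : a ^ 2 + b ^ 2 = 1 / 2) :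
    diagPt a b ∈ Btilde :=
  mem_Btilde_iff.2 ⟨1, a, b, hb, hab, h, (act_one _).symm⟩

/-- The derivative of `Y p q` in the direction of `Ê q r`. -/
theorem fderivWithin_Yfield {a b : ℝ} (hb : 0 < b) (hab : b < a) (h : a ^ 2 + b ^ 2 = 1 / 2)
    {p q r : Fin 4} (hpq : p ≠ q) (hqr : q ≠ r) (hpr : p ≠ r) :
    fderivWithin ℝ (Yfield localDiag p q) Btilde (diagPt a b) (Ehat q r) =
      (√2 * (![a, -a, b, -b] q - ![a, -a, b, -b] r))⁻¹ • Ehat p r := by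
  have hc : √2 * (![a, -a, b, -b] q - ![a, -a, b, -b] r) ≠ 0 :=
    mul_ne_zero (by positivity) (planeIdx_sub_ne_zero hb hab hqr)
  have hmem := diagPt_mem hb hab h
  have hcos : ∀ᶠ t in 𝓝 (0 : ℝ), 0 < Real.cos t :=
    Real.continuous_cos.continuousAt.eventually_const_lt (by simp)
  -- Along the rotation of D in the plane (q, r) the diagonalizer is the rotation itself, so the
  -- field is the rotated Ê_pq, whose velocity is the commutator Ê_pr. The velocity of the curve is
  -- √2(μ_q - μ_r) Ê_qr.
  have h1 := fderivWithin_apply_of_curve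
    (differentiableWithinAt_Yfield ⟨hmem, diagPt_mem_diagDomain hb hab h⟩ p q)
    (γ := fun t => act (rotSO hqr t) (diagPt a b)) (by simp [rotSO_zero])
    (hasDerivAt_act_rot_diagonal hqr (toMat_diagPt a b))
    (Filter.Eventually.of_forall fun t => by
      simpa using act_rotSO_mul_mem (P := 1) hb hab h hqr t)
    ((hasDerivAt_act_rot hqr (toMat_Ehat_commutator hpq hqr hpr)).congr_of_eventuallyEq
      (hcos.mono fun t ht => by
        change act (localDiag (act (rotSO hqr t) (diagPt a b))) (Ehat p q) = _
        rw [localDiag_act hb hab h (rot_apply_self_pos hqr ht)]))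
  rw [map_smul] at h1
  rw [← h1, inv_smul_smul₀ hc]

theorem Yfield_localDiag_diagPt {a b : ℝ} (hb : 0 < b) (hab : b < a) (h : a ^ 2 + b ^ 2 = 1 / 2)
    (i j : Fin 4) : Yfield localDiag i j (diagPt a b) = Ehat i j := by
  rw [Yfield, (isLocalDiagonalizer_localDiag hb hab h).2.2.1, act_one]

/-- Both derivatives are multiples of Ê_pr, and the coefficient is the difference of 1/(μ_q - μ_r)
and 1/(μ_q - μ_p), divided by √2. -/
theorem lieBracketWithin_Yfield {a b : ℝ} (hb : 0 < b) (hab : b < a) (h : a ^ 2 + b ^ 2 = 1 / 2)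
    {p q r : Fin 4} (hpq : p ≠ q) (hqr : q ≠ r) (hpr : p ≠ r) :
    VectorField.lieBracketWithin ℝ (Yfield localDiag q r) (Yfield localDiag p q) Btilde
      (diagPt a b) = (1 / √2 * ((![a, -a, b, -b] r - ![a, -a, b, -b] p) /
        ((![a, -a, b, -b] q - ![a, -a, b, -b] r) * (![a, -a, b, -b] q - ![a, -a, b, -b] p)))) •
          Ehat p r := by
  have h1 := planeIdx_sub_ne_zero hb hab hqr
  have h2 := planeIdx_sub_ne_zero hb hab hpq.symm
  rw [VectorField.lieBracketWithin, Yfield_localDiag_diagPt hb hab h,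
    Yfield_localDiag_diagPt hb hab h, fderivWithin_Yfield hb hab h hpq hqr hpr,
    Yfield_comm _ q r, Ehat_comm p q, fderivWithin_Yfield hb hab h hqr.symm hpq.symm hpr.symm,
    Ehat_comm r p, ← sub_smul]
  congr 1
  generalize (![a, -a, b, -b] : Fin 4 → ℝ) = μ at *
  field_simp
  ring

/-! ### Non-integrability of the conullities -/

theorem norm_sq_Ehat {i j : Fin 4} (h : i ≠ j) : ⟪Ehat i j, Ehat i j⟫ = 1 := by
  rw [inner_Ehat _ h, toMat_Ehat h]
  simp [h.symm]

/-- The members of the frame which span the `i`-th principal space. -/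
def frameIndices : Fin 5 → Set (Fin 7) := ![{1}, {4}, {2}, {3}, {0, 5, 6}]

theorem principalSpace_kappa_localDiag {B : SymMat} (hB : B ∈ Btilde ∩ diagDomain) (i : Fin 5) :
    principalSpace Btilde unitNormal B (kappa i B) =
      Submodule.span ℝ ((fun s => frame localDiag s B) '' frameIndices i) := by
  obtain ⟨-, a, b, hb, hab, h, hB'⟩ := localDiag_spec hB
  simp only [frame_act_diagPt hB']
  conv_lhs => rw [hB']
  exact principalSpace_kappa _ hb hab h i

/-- A distribution which near `diag (a, -a, b, -b)` is the orthogonal complement of a principal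
distribution containing `Y p r`, but neither `Y q r` nor `Y p q`, is not integrable. -/
theorem not_isIntegrable_of_frame {a b : ℝ} (hb : 0 < b) (hab : b < a)
    (h : a ^ 2 + b ^ 2 = 1 / 2) {i : Fin 5} {T : SymMat → Submodule ℝ SymMat}
    (hT : ∀ᶠ B in 𝓝[Btilde] (diagPt a b),
      T B = principalSpace Btilde unitNormal B (kappa i B)) {p q r : Fin 4}
    (hpq : p ≠ q) (hqr : q ≠ r) (hpr : p ≠ r) {n x z : Fin 7} (hn : n ∈ frameIndices i)
    (hx : x ∉ frameIndices i) (hz : z ∉ frameIndices i)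
    (hnY : ∀ B, frame localDiag n B = Yfield localDiag p r B)
    (hxE : frameAt a b x = Ehat q r) (hzE : frameAt a b z = Ehat p q) :
    ¬ IsIntegrable Btilde fun B => tangentSpace Btilde B ⊓ (T B)ᗮ := by
  intro hint
  have hA := diagPt_mem hb hab h
  have hAd : diagPt a b ∈ Btilde ∩ diagDomain := ⟨hA, diagPt_mem_diagDomain hb hab h⟩
  obtain ⟨k, O, f, ⟨hO, hf, hfM⟩, ⟨x₀, hx₀, hfx⟩, hr⟩ := hint _ hA
  obtain ⟨U, N, hU, hAU, hN, hNY⟩ := (isSmoothOn_Yfield p r).exists_differentiableAt hAd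
  have hfc : ContinuousAt f x₀ := (hf x₀ hx₀).continuousWithinAt.continuousAt (hO.mem_nhds hx₀)
  have hfM' : ∀ᶠ y in 𝓝 x₀, f y ∈ Btilde := by
    filter_upwards [hO.mem_nhds hx₀] with y hy using (hfM y hy).1
  have hlim : Filter.Tendsto f (𝓝 x₀) (𝓝[Btilde] (diagPt a b)) := by
    rw [← hfx]
    exact tendsto_nhdsWithin_iff.2 ⟨hfc, hfM'⟩
  have hUd : ∀ᶠ B in 𝓝[Btilde] (diagPt a b), B ∈ U ∩ diagDomain :=
    mem_nhdsWithin_of_mem_nhds ((hU.inter isOpen_diagDomain).mem_nhds ⟨hAU, hAd.2⟩)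
  -- The extension N of Y_pr is normal to the integral manifold, since Y_pr lies in the distribution
  -- whose complement is integrated.
  have hperp : ∀ᶠ y in 𝓝 x₀, ∀ u, ⟪N (f y), fderiv ℝ f y u⟫ = 0 := by
    filter_upwards [hO.mem_nhds hx₀, hlim.eventually hT, hlim.eventually hUd] with y hy hTy hUy u
    have h1 : fderiv ℝ f y u ∈ tangentSpace Btilde (f y) ⊓ (T (f y))ᗮ :=
      (hr y hy).le ⟨u, rfl⟩
    have hfy : f y ∈ Btilde ∩ diagDomain := ⟨(hfM y hy).1, hUy.2⟩
    have h2 : N (f y) ∈ T (f y) := by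
      rw [hTy, principalSpace_kappa_localDiag hfy, ← hNY (f y) ⟨hfy, hUy.1⟩, ← hnY]
      exact Submodule.subset_span ⟨n, hn, rfl⟩
    exact (Submodule.mem_orthogonal _ _).1 h1.2 _ h2
  have hmem : ∀ s, s ∉ frameIndices i → ∃ u, fderiv ℝ f x₀ u = frameAt a b s := by
    intro s hs
    have h1 : frameAt a b s ∈ tangentSpace Btilde (f x₀) ⊓ (T (f x₀))ᗮ := by
      rw [hfx, hT.self_of_nhdsWithin hA]
      refine ⟨by simpa using act_frameAt_mem_tangentSpace 1 hb hab h s, ?_⟩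
      have h2 := principalSpace_kappa 1 hb hab h i
      simp only [act_one] at h2
      rw [h2]
      refine (Submodule.mem_orthogonal _ _).2 fun u hu => ?_
      induction hu using Submodule.span_induction with
      | mem v hv =>
        obtain ⟨t, ht, rfl⟩ := hv
        exact frameAt_orthogonal h fun hts => hs (hts ▸ ht)
      | zero => exact inner_zero_left _
      | add v w _ _ hv hw => rw [inner_add_left, hv, hw, add_zero]
      | smul c v _ hv => rw [inner_smul_symMat, hv, mul_zero]
    exact (hr x₀ hx₀).ge h1
  obtain ⟨u, hu⟩ := hmem x hx
  obtain ⟨w, hw⟩ := hmem z hz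
  have hN' : DifferentiableAt ℝ N (f x₀) := by rwa [hfx]
  have key := inner_fderiv_symm_of_orthogonal hO hx₀ hf hN' hperp u w
  have hext : ∀ s, fderiv ℝ N (diagPt a b) (frameAt a b s) =
      fderivWithin ℝ (Yfield localDiag p r) Btilde (diagPt a b) (frameAt a b s) := fun s =>
    (fderivWithin_eq_of_extension (hU.inter isOpen_diagDomain) ⟨hAU, hAd.2⟩ hA hN
      (fun B hB => hNY B ⟨⟨hB.1, hB.2.2⟩, hB.2.1⟩)
      (by simpa using act_frameAt_mem_tangentSpace 1 hb hab h s)).symm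
  -- Symmetry for the tangent vectors Ê_qr and Ê_pq becomes 1/(μ_r - μ_q) = 1/(μ_p - μ_q), forcing
  -- μ_p = μ_r.
  rw [hu, hw, hfx, hext, hext, hxE, hzE, Ehat_comm q r,
    fderivWithin_Yfield hb hab h hpr hqr.symm hpq,
    Yfield_comm, fderivWithin_Yfield hb hab h hpr.symm hpq hqr.symm, inner_smul_symMat,
    inner_smul_symMat, norm_sq_Ehat hpq, norm_sq_Ehat hqr.symm, mul_one, mul_one, inv_inj] at key
  have h3 := mul_left_cancel₀ (by positivity : √2 ≠ (0 : ℝ)) key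
  refine planeIdx_sub_ne_zero hb hab hpr ?_
  linarith

/-- Each case chooses a triangle p, q, r of indices of which exactly the edge pr gives a frame
vector in the i-th principal space. -/
theorem not_isIntegrable_conullity {a b : ℝ} (hb : 0 < b) (hab : b < a)
    (h : a ^ 2 + b ^ 2 = 1 / 2) (i : Fin 5) {T : SymMat → Submodule ℝ SymMat}
    (hT : ∀ᶠ B in 𝓝[Btilde] (diagPt a b),
      T B = principalSpace Btilde unitNormal B (kappa i B)) :
    ¬ IsIntegrable Btilde fun B => tangentSpace Btilde B ⊓ (T B)ᗮ := by
  fin_cases i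
  · exact not_isIntegrable_of_frame hb hab h hT (p := 0) (q := 1) (r := 2) (n := 1) (x := 3)
      (z := 0) (by decide) (by decide) (by decide) (by simp [frameIndices])
      (by simp [frameIndices]) (by simp [frameIndices]) (fun _ => rfl) rfl rfl
  · exact not_isIntegrable_of_frame hb hab h hT (p := 1) (q := 0) (r := 3) (n := 4) (x := 2)
      (z := 0) (by decide) (by decide) (by decide) (by simp [frameIndices])
      (by simp [frameIndices]) (by simp [frameIndices]) (fun _ => rfl) rfl (Ehat_comm 0 1)
  · exact not_isIntegrable_of_frame hb hab h hT (p := 0) (q := 1) (r := 3) (n := 2) (x := 4)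
      (z := 0) (by decide) (by decide) (by decide) (by simp [frameIndices])
      (by simp [frameIndices]) (by simp [frameIndices]) (fun _ => rfl) rfl rfl
  · exact not_isIntegrable_of_frame hb hab h hT (p := 1) (q := 0) (r := 2) (n := 3) (x := 1)
      (z := 0) (by decide) (by decide) (by decide) (by simp [frameIndices])
      (by simp [frameIndices]) (by simp [frameIndices]) (fun _ => rfl) rfl (Ehat_comm 0 1)
  · exact not_isIntegrable_of_frame hb hab h hT (p := 2) (q := 0) (r := 3) (n := 5) (x := 2)
      (z := 1) (by decide) (by decide) (by decide) (by simp [frameIndices])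
      (by simp [frameIndices]) (by simp [frameIndices]) (fun _ => rfl) rfl (Ehat_comm 0 2)

theorem exists_eigenvalue_pair : ∃ a b : ℝ, 0 < b ∧ b < a ∧ a ^ 2 + b ^ 2 = 1 / 2 :=
  ⟨7 / 10, 1 / 10, by norm_num, by norm_num, by norm_num⟩

theorem isWeaklyIrreducible_Btilde : IsWeaklyIrreducible Btilde := by
  refine ⟨isProperDupin_Btilde, ?_⟩
  rintro ⟨ξ, hξ, lam, hlam, hpc, hint⟩
  obtain ⟨a, b, hb, hab, h⟩ := exists_eigenvalue_pair
  obtain ⟨i, hi⟩ := exists_kappa_of_principalCurvature hξ hlam hpc (diagPt_mem hb hab h)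
  exact not_isIntegrable_conullity hb hab h i hi hint

/-! ### The curvatures in terms of `rho`, and the frame at nearby points -/

theorem kappa_eq_div_rho (P : SO4) {a b : ℝ} (hb : 0 < b) (hab : b < a)
    (h : a ^ 2 + b ^ 2 = 1 / 2) :
    3 / rho (act P (diagPt a b)) * (a + b) = 1 / (a - b) ∧
      3 / rho (act P (diagPt a b)) * (a - b) = 1 / (a + b) := by
  have h1 : a - b ≠ 0 := (sub_pos.2 hab).ne'
  have h2 : a + b ≠ 0 := by linarith
  rw [rho_act, rho_diagPt hb hab h, show a ^ 2 - b ^ 2 = (a - b) * (a + b) by ring]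
  constructor <;> field_simp

theorem span_frame_localDiag {B : SymMat} (hB : B ∈ Btilde ∩ diagDomain) :
    Submodule.span ℝ (Set.range fun s => frame localDiag s B) = tangentSpace Btilde B := by
  obtain ⟨-, a, b, hb, hab, h, hB'⟩ := localDiag_spec hB
  simp only [frame_act_diagPt hB']
  conv_rhs => rw [hB']
  exact (tangentSpace_act_diagPt _ hb hab h).symm

theorem frame_localDiag_ne_zero {B : SymMat} (hB : B ∈ Btilde ∩ diagDomain) (s : Fin 7) :
    frame localDiag s B ≠ 0 := by
  obtain ⟨-, a, b, hb, hab, h, hB'⟩ := localDiag_spec hB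
  rw [frame_act_diagPt hB']
  exact act_frameAt_ne_zero _ hb hab h s

theorem frame_localDiag_orthogonal {B : SymMat} (hB : B ∈ Btilde ∩ diagDomain) :
    Pairwise fun s t => ⟪frame localDiag s B, frame localDiag t B⟫ = 0 := by
  obtain ⟨-, a, b, hb, hab, h, hB'⟩ := localDiag_spec hB
  intro s t hst
  rw [frame_act_diagPt hB', frame_act_diagPt hB', inner_act_act]
  exact frameAt_orthogonal h hst

end AustereDupin

end

theorem mainTheorem6 :
    -- the hypersurface is proper Dupin and weakly irreducible
    IsWeaklyIrreducible Btilde ∧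
    IsUnitNormal Btilde unitNormal ∧
    -- the five principal curvature functions
    ∃ κ : Fin 5 → SymMat → ℝ,
      (∀ i, IsSmoothOn (κ i) Btilde) ∧
      (∀ (P : SO4) (a b : ℝ) (A : SymMat), 0 < b → b < a → ‖diagPt a b‖ = 1 →
          A = act P (diagPt a b) →
        κ 0 A = 3 / rho A * (a + b) ∧ κ 1 A = -(3 / rho A * (a + b)) ∧
        κ 2 A = 3 / rho A * (a - b) ∧ κ 3 A = -(3 / rho A * (a - b)) ∧ κ 4 A = 0) ∧
      (∀ A ∈ Btilde, Function.Injective (fun i => κ i A) ∧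
        {c : ℝ | IsPrincipalCurvature Btilde unitNormal A c} = Set.range (fun i => κ i A)) ∧
      -- none of the five conullities is integrable
      (∀ i, ¬ IsIntegrable Btilde (conullity Btilde unitNormal (κ i))) ∧
      -- the local orthogonal frame adapted to the principal distributions, and its Lie brackets
      ∀ (a b : ℝ) (A : SymMat) (μ : Fin 4 → ℝ), 0 < b → b < a → A = diagPt a b → ‖A‖ = 1 →
        μ = ![a, -a, b, -b] →
        ∃ (W : Set SymMat) (P : SymMat → SO4), IsLocalDiagonalizer A W P ∧
          (∀ s, IsSmoothOn (frame P s) (Btilde ∩ W)) ∧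
          (∀ B ∈ Btilde ∩ W,
            (∀ s, frame P s B ≠ 0) ∧
            (Pairwise fun s t => ⟪frame P s B, frame P t B⟫ = 0) ∧
            Submodule.span ℝ (Set.range fun s => frame P s B) = tangentSpace Btilde B ∧
            principalSpace Btilde unitNormal B (κ 0 B) = Submodule.span ℝ {Yfield P 0 2 B} ∧
            principalSpace Btilde unitNormal B (κ 1 B) = Submodule.span ℝ {Yfield P 1 3 B} ∧
            principalSpace Btilde unitNormal B (κ 2 B) = Submodule.span ℝ {Yfield P 0 3 B} ∧
            principalSpace Btilde unitNormal B (κ 3 B) = Submodule.span ℝ {Yfield P 1 2 B} ∧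
            principalSpace Btilde unitNormal B (κ 4 B) =
              Submodule.span ℝ {Yfield P 0 1 B, Yfield P 2 3 B, X1 B}) ∧
          VectorField.lieBracketWithin ℝ (Yfield P 0 1) (Yfield P 1 2) Btilde A =
            (-(1 / √2) * ((μ 0 - μ 2) / ((μ 0 - μ 1) * (μ 1 - μ 2)))) • Ehat 0 2 ∧
          VectorField.lieBracketWithin ℝ (Yfield P 0 1) (Yfield P 0 3) Btilde A =
            (1 / √2 * ((μ 1 - μ 3) / ((μ 0 - μ 1) * (μ 0 - μ 3)))) • Ehat 1 3 ∧
          VectorField.lieBracketWithin ℝ (Yfield P 0 1) (Yfield P 1 3) Btilde A =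
            (-(1 / √2) * ((μ 0 - μ 3) / ((μ 0 - μ 1) * (μ 1 - μ 3)))) • Ehat 0 3 ∧
          VectorField.lieBracketWithin ℝ (Yfield P 0 1) (Yfield P 0 2) Btilde A =
            (1 / √2 * ((μ 1 - μ 2) / ((μ 0 - μ 1) * (μ 0 - μ 2)))) • Ehat 1 2 ∧
          VectorField.lieBracketWithin ℝ (Yfield P 0 2) (Yfield P 0 3) Btilde A =
            (1 / √2 * ((μ 2 - μ 3) / ((μ 0 - μ 2) * (μ 0 - μ 3)))) • Ehat 2 3 := by
  refine ⟨isWeaklyIrreducible_Btilde, isUnitNormal_unitNormal, kappa, isSmoothOn_kappa, ?_, ?_, ?_,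
    ?_⟩
  · rintro P a b A hb hab hn rfl
    have h := (norm_diagPt_eq_one_iff a b).1 hn
    obtain ⟨h1, h2⟩ := kappa_eq_div_rho P hb hab h
    rw [h1, h2]
    exact ⟨kappa_act_diagPt P hb hab h 0, kappa_act_diagPt P hb hab h 1,
      kappa_act_diagPt P hb hab h 2, kappa_act_diagPt P hb hab h 3, kappa_act_diagPt P hb hab h 4⟩
  · intro A hA
    refine ⟨kappa_injective hA, ?_⟩
    ext c
    exact isPrincipalCurvature_iff hA c
  · intro i
    obtain ⟨a, b, hb, hab, h⟩ := exists_eigenvalue_pair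
    exact not_isIntegrable_conullity hb hab h i (Filter.Eventually.of_forall fun _ => rfl)
  · rintro a b A μ hb hab rfl hn rfl
    have h := (norm_diagPt_eq_one_iff a b).1 hn
    refine ⟨diagDomain, localDiag, isLocalDiagonalizer_localDiag hb hab h, isSmoothOn_frame,
      fun B hB => ⟨frame_localDiag_ne_zero hB, frame_localDiag_orthogonal hB,
        span_frame_localDiag hB, ?_, ?_, ?_, ?_, ?_⟩, ?_, ?_, ?_, ?_, ?_⟩
    · exact (principalSpace_kappa_localDiag hB 0).trans (congrArg _ Set.image_singleton)
    · exact (principalSpace_kappa_localDiag hB 1).trans (congrArg _ Set.image_singleton)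
    · exact (principalSpace_kappa_localDiag hB 2).trans (congrArg _ Set.image_singleton)
    · exact (principalSpace_kappa_localDiag hB 3).trans (congrArg _ Set.image_singleton)
    · refine (principalSpace_kappa_localDiag hB 4).trans ?_
      congr 1
      change (fun s => frame localDiag s B) '' {0, 5, 6} = _
      rw [Set.image_insert_eq, Set.image_pair]
      rfl
    -- Each bracket has one common index q. Symmetry of Y in its indices brings it to the form
    -- [Y_qr, Y_pq] of the general formula; for q = 1 a sign is left when μ 1 - μ 0 is reversed.
    · rw [Yfield_comm _ 0 1, Yfield_comm _ 1 2,
        lieBracketWithin_Yfield hb hab h (by decide) (by decide) (by decide), Ehat_comm 2 0]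
      congr 1
      rw [← neg_sub (![a, -a, b, -b] 0), neg_mul, div_neg, mul_neg, neg_mul]
    · rw [Yfield_comm _ 0 3,
        lieBracketWithin_Yfield hb hab h (by decide) (by decide) (by decide), Ehat_comm 3 1]
    · rw [Yfield_comm _ 0 1, Yfield_comm _ 1 3,
        lieBracketWithin_Yfield hb hab h (by decide) (by decide) (by decide), Ehat_comm 3 0]
      congr 1
      rw [← neg_sub (![a, -a, b, -b] 0), neg_mul, div_neg, mul_neg, neg_mul]
    · rw [Yfield_comm _ 0 2,
        lieBracketWithin_Yfield hb hab h (by decide) (by decide) (by decide), Ehat_comm 2 1]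
    · rw [Yfield_comm _ 0 3,
        lieBracketWithin_Yfield hb hab h (by decide) (by decide) (by decide), Ehat_comm 3 2]
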